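/- Let $\triangle=[v_1,v_2,v_3]\subset\mathbb R^2$ be a nondegenerate closed triangle, and put $v_4=\frac{v_1+v_2}2$, $v_5=\frac{v_2+v_3}2$, $v_6=\frac{v_1+v_3}2$, $v_7=\frac{v_4+v_6}2$, $v_8=\frac{v_4+v_5}2$, $v_9=\frac{v_5+v_6}2$, $v_{10}=\frac{v_1+v_2+v_3}3$. The lines joining the vertices and edge midpoints of $\triangle$ divide it into 12 triangular faces (the Powell–Sabin 12-split, with vertices $v_1,\dots,v_{10}$). Let $\mathcal S^3_5$ be the space of $C^3$ functions on $\triangle$ whose restriction to each face is a polynomial of total degree at most $5$. Fix a rule assigning each point of $\triangle$ to one face containing it. For a finite multiset $K$ of points $v_j$, let $[K]$ be its convex hull and $[K)$ the set of points of $\triangle$ assigned to faces contained in $[K]$. The simplex spline $Q[K]$ is defined recursively by $Q[K]=0$ if $\mathrm{area}[K]=0$; $Q[K]=\mathbf 1_{[K)}\,\mathrm{area}(\triangle)/\mathrm{area}[K]$ if $|K|=3$ and $\mathrm{area}[K]\ne0$; and otherwise $Q[K](x)=\sum_j\beta_jQ[K\setminus v_j](x)$, where $x=\sum_j\beta_jv_j$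 is an affine combination of knots of $K$ (for definiteness, the barycentric representation with respect to the first noncollinear triple of knots). Write $Q_{ijklmn}=Q[v_1^iv_2^jv_3^kv_4^lv_5^mv_6^n]$. Consider the following scaled simplex splines $S=wQ[K]$, each given together with a family of five dual points (exponents are multiplicities): - $a$: $\frac14Q_{600101}$, $v_1^5$; - $b$: $\frac14Q_{500201}$, $v_1^4v_4$; - $e$: $\frac12Q_{410201}$, $v_1^3v_4^2$; - $f$: $\frac12Q_{320201}$, $v_1^2v_2v_4^2$; - $g$: $\frac34Q_{220211}$, $v_1v_2v_4^2v_{10}$; - $g'$: $\frac14Q_{220211}$, $v_1v_2v_3v_4^2$; - $l$: $Q_{141110}$, $v_2^3v_4v_5$; - $n$: $\frac34Q_{222110}$, $v_1v_2^2v_3v_{10}$; - $o$: $\frac34Q_{221111}$, $v_1v_2v_3v_4v_{10}$; - $q$: $Q_{321200}$, $v_1^2v_2v_4^2$; - $r$: $\frac12Q_{131210}$, $v_1v_2^2v_4v_5$; - $s$: $\frac34Q_{221210}$, $v_1v_2^2v_4v_{10}$; - $s'$: $\frac14Q_{221210}$, $v_1v_2^2v_3v_4$; - $t$: $\frac34Q_{121211}$,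 $v_1v_2v_4v_5v_{10}$; - $t'$: $\frac12Q_{121211}$, $v_1v_2v_3v_4v_8$. The six bases $\mathcal B_a,\dots,\mathcal B_f$ consist of all images, under the permutations of $v_1,\dots,v_{10}$ induced by permuting the corners $v_1,v_2,v_3$, of $\{a,b,e,f,l,n,r,s\}$, $\{a,b,e,f,l,o,r,s\}$, $\{a,b,e,f,g,l,r,t\}$, $\{a,b,e,l,n,q,r,s'\}$, $\{a,b,e,l,o,q,r,s'\}$, $\{a,b,e,g',l,q,r,t'\}$, respectively; each has 39 elements $S_1,\dots,S_{39}$. Let $p^*_{i,1},\dots,p^*_{i,5}$ be the dual points of $S_i$, and for $f\in C^0(\triangle)$ put $$Q(f)=\sum_{i=1}^{39}L_i(f)S_i,\qquad L_i(f)=\sum_{k=1}^5\frac{k^5}{5!}(-1)^{k-1}\sum_{1\le r_1<\dots<r_k\le5}f\Big(\frac{p^*_{i,r_1}+\dots+p^*_{i,r_k}}k\Big).$$ Then, for each of the six bases and every nondegenerate triangle $\triangle$: 1. $Q$ maps $C^0(\triangle)$ into $\mathcal S^3_5$; 2. $Q(p)=p$ on $\triangle$ for every polynomial $p$ of total degree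 at most $5$; 3. $\|Q(f)\|_{L_\infty(\triangle)}\le\frac{275}3\|f\|_{L_\infty(\triangle)}$ for every $f\in C^0(\triangle)$; 4. $Q$ has local approximation order $6$: there is an absolute constant $C$, independent of the triangle, of the basis and of $f$, such that for every $f\in C^0(\triangle)$ whose weak derivatives of order at most $6$ in the interior of $\triangle$ lie in $L_\infty$, $$\|Q(f)-f\|_{L_\infty(\triangle)}\le C\,h^6\max_{|\alpha|=6}\|D^\alpha f\|_{L_\infty(\triangle)},\qquad h=\operatorname{diam}\triangle .$$ -/

import Mathlib

open MeasureTheory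
open scoped ContDiff ENNReal

namespace PS12

/-- The Euclidean plane. -/
abbrev Plane : Type := EuclideanSpace ℝ (Fin 2)

/-! ### The Powell-Sabin 12-split.  Vertices `v₁, …, v₁₀` are indexed by `0, …, 9`. -/

/-- The closed triangle with vertices `v 0, v 1, v 2`. -/
def triangle (v : Fin 3 → Plane) : Set Plane := convexHull ℝ (Set.range v)

/-- The ten vertices of the 12-split: the three corners, the midpoints of the edges
`[v₁, v₂]`, `[v₂, v₃]`, `[v₁, v₃]`, then `(v₄ + v₆)/2`, `(v₄ + v₅)/2`, `(v₅ + v₆)/2`, and the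
barycentre. -/
noncomputable def vertex (v : Fin 3 → Plane) : Fin 10 → Plane :=
  let v₄ := (1 / 2 : ℝ) • (v 0 + v 1)
  let v₅ := (1 / 2 : ℝ) • (v 1 + v 2)
  let v₆ := (1 / 2 : ℝ) • (v 0 + v 2)
  ![v 0, v 1, v 2, v₄, v₅, v₆,
    (1 / 2 : ℝ) • (v₄ + v₆), (1 / 2 : ℝ) • (v₄ + v₅), (1 / 2 : ℝ) • (v₅ + v₆),
    (1 / 3 : ℝ) • (v 0 + v 1 + v 2)]

/-- The vertices of the twelve faces of the 12-split (the numbering of the faces is immaterial). -/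
def faceVertices : Fin 12 → Fin 3 → Fin 10 :=
  ![![0, 3, 6], ![0, 5, 6], ![1, 3, 7], ![1, 4, 7], ![2, 4, 8], ![2, 5, 8],
    ![9, 3, 6], ![9, 3, 7], ![9, 4, 7], ![9, 4, 8], ![9, 5, 8], ![9, 5, 6]]

/-- The closed faces of the 12-split. -/
noncomputable def face (v : Fin 3 → Plane) (k : Fin 12) : Set Plane :=
  triangle fun i => vertex v (faceVertices k i)

/-- A scheme assigning every point of the macrotriangle to a unique face containing it. -/
def IsFaceScheme (v : Fin 3 → Plane) (ρ : Plane → Fin 12) : Prop :=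
  ∀ x ∈ triangle v, x ∈ face v (ρ x)

/-- The half-open faces determined by the scheme `ρ`. -/
def halfOpenFace (v : Fin 3 → Plane) (ρ : Plane → Fin 12) (k : Fin 12) : Set Plane :=
  {x | x ∈ face v k ∧ ρ x = k}

/-- The space `S^r_d` of `C^r` splines of degree at most `d` on the 12-split.  Only the values on
the closed macrotriangle matter. -/
def splineSpace (v : Fin 3 → Plane) (r d : ℕ) : Set (Plane → ℝ) :=
  {s | ContDiffOn ℝ r s (triangle v) ∧
    ∀ k : Fin 12, ∃ p : MvPolynomial (Fin 2) ℝ, p.totalDegree ≤ d ∧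
      ∀ x ∈ face v k, s x = MvPolynomial.eval (fun i => x i) p}

/-! ### Simplex splines.  A knot multiset is a `Multiset (Fin 10)` of indices of vertices. -/

/-- The convex hull `[K]` of a knot multiset. -/
noncomputable def hull (v : Fin 3 → Plane) (K : Multiset (Fin 10)) : Set Plane :=
  convexHull ℝ (vertex v '' {j | j ∈ K})

/-- The half-open convex hull `[K)`: the union of the half-open faces of the faces in `[K]`. -/
noncomputable def halfOpenHull (v : Fin 3 → Plane) (ρ : Plane → Fin 12)
    (K : Multiset (Fin 10)) : Set Plane :=
  ⋃ k ∈ {k : Fin 12 | face v k ⊆ hull v K}, halfOpenFace v ρ k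

/-- Area of a subset of the plane. -/
noncomputable def area (A : Set Plane) : ℝ := (volume A).toReal

/-- Twice the signed area of the triangle with vertices `a, b, c`. -/
def orient (a b c : Plane) : ℝ :=
  (b 0 - a 0) * (c 1 - a 1) - (b 1 - a 1) * (c 0 - a 0)

/-- All triples `(i, j, k)` with `i < j < k`, in lexicographic order. -/
def triples : List (Fin 10 × Fin 10 × Fin 10) :=
  (List.finRange 10 ×ˢ (List.finRange 10 ×ˢ List.finRange 10)).filter
    fun t => t.1 < t.2.1 ∧ t.2.1 < t.2.2

open Classical in
/-- The first triple of knots in `K` that are not collinear, if there is one. -/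
noncomputable def knotTriple (v : Fin 3 → Plane) (K : Multiset (Fin 10)) :
    Option (Fin 10 × Fin 10 × Fin 10) :=
  triples.find? fun t => t.1 ∈ K ∧ t.2.1 ∈ K ∧ t.2.2 ∈ K ∧
    orient (vertex v t.1) (vertex v t.2.1) (vertex v t.2.2) ≠ 0

open Classical in
/-- The recursion for the simplex spline with `d + 3` knots.  In each step `x` is written as an
affine combination `∑ βⱼ vⱼ` of knots of `K`; since the outcome does not depend on which affine
combination is taken, we take the barycentric coordinates of `x` with respect to the first
noncollinear triple of knots (all other `βⱼ` being zero). -/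
noncomputable def simplexSplineAux (v : Fin 3 → Plane) (ρ : Plane → Fin 12) :
    ℕ → Multiset (Fin 10) → Plane → ℝ
  | 0, K, x =>
      if area (hull v K) = 0 then 0
      else (halfOpenHull v ρ K).indicator (fun _ => area (triangle v) / area (hull v K)) x
  | d + 1, K, x =>
      if area (hull v K) = 0 then 0
      else match knotTriple v K with
        | none => 0
        | some (i, j, k) =>
            let a := vertex v i
            let b := vertex v j
            let c := vertex v k
            orient x b c / orient a b c * simplexSplineAux v ρ d (K.erase i) x +
            orient a x c / orient a b c * simplexSplineAux v ρ d (K.erase j) x +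
            orient a b x / orient a b c * simplexSplineAux v ρ d (K.erase k) x

/-- The area normalized simplex spline `Q[K]`, of degree `|K| - 3`. -/
noncomputable def simplexSpline (v : Fin 3 → Plane) (ρ : Plane → Fin 12)
    (K : Multiset (Fin 10)) : Plane → ℝ :=
  simplexSplineAux v ρ (K.card - 3) K

/-! ### The six bases -/

/-- A scaled simplex spline `w • Q[K]`, together with its multiset of dual points. -/
structure BasisElement where
  weight : ℚ
  knots : Multiset (Fin 10)
  dual : Multiset (Fin 10)

instance : DecidableEq BasisElement := fun a b =>
  decidable_of_iff (a.weight = b.weight ∧ a.knots = b.knots ∧ a.dual = b.dual)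
    (by cases a; cases b; simp)

/-- The knot multiset `v₁^i v₂^j v₃^k v₄^l v₅^m v₆^n`. -/
def kn (i j k l m n : ℕ) : Multiset (Fin 10) :=
  Multiset.replicate i 0 + Multiset.replicate j 1 + Multiset.replicate k 2 +
    Multiset.replicate l 3 + Multiset.replicate m 4 + Multiset.replicate n 5

/-- The permutation of the ten vertices induced by a permutation of the three corners. -/
def symVertex (σ : Equiv.Perm (Fin 3)) : Fin 10 → Fin 10 :=
  let corner : Fin 3 → Fin 10 := ![0, 1, 2]
  -- midpoint of the edge opposite to a corner
  let opposite : Fin 3 → Fin 10 := ![4, 5, 3]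
  -- midpoint of the two edge midpoints next to a corner
  let inner : Fin 3 → Fin 10 := ![6, 7, 8]
  ![corner (σ 0), corner (σ 1), corner (σ 2), opposite (σ 2), opposite (σ 0), opposite (σ 1),
    inner (σ 0), inner (σ 1), inner (σ 2), 9]

def BasisElement.sym (σ : Equiv.Perm (Fin 3)) (b : BasisElement) : BasisElement :=
  ⟨b.weight, b.knots.map (symVertex σ), b.dual.map (symVertex σ)⟩

/-- Representatives, one for each symmetry class, of the six bases `B_a, …, B_f`.  The third entry
lists the dual points: the linear factor `c_j` of the dual polynomial has index `j - 1`. -/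
def representatives : Fin 6 → List BasisElement :=
  let qa : BasisElement := ⟨1/4, kn 6 0 0 1 0 1, {0, 0, 0, 0, 0}⟩
  let qb : BasisElement := ⟨1/4, kn 5 0 0 2 0 1, {0, 0, 0, 0, 3}⟩
  let qe : BasisElement := ⟨1/2, kn 4 1 0 2 0 1, {0, 0, 0, 3, 3}⟩
  let qf : BasisElement := ⟨1/2, kn 3 2 0 2 0 1, {0, 0, 1, 3, 3}⟩
  let qg : BasisElement := ⟨3/4, kn 2 2 0 2 1 1, {0, 1, 3, 3, 9}⟩
  let qg' : BasisElement := ⟨1/4, kn 2 2 0 2 1 1, {0, 1, 2, 3, 3}⟩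
  let ql : BasisElement := ⟨1, kn 1 4 1 1 1 0, {1, 1, 1, 3, 4}⟩
  let qn : BasisElement := ⟨3/4, kn 2 2 2 1 1 0, {0, 1, 1, 2, 9}⟩
  let qo : BasisElement := ⟨3/4, kn 2 2 1 1 1 1, {0, 1, 2, 3, 9}⟩
  let qq : BasisElement := ⟨1, kn 3 2 1 2 0 0, {0, 0, 1, 3, 3}⟩
  let qr : BasisElement := ⟨1/2, kn 1 3 1 2 1 0, {0, 1, 1, 3, 4}⟩
  let qs : BasisElement := ⟨3/4, kn 2 2 1 2 1 0, {0, 1, 1, 3, 9}⟩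
  let qs' : BasisElement := ⟨1/4, kn 2 2 1 2 1 0, {0, 1, 1, 2, 3}⟩
  let qt : BasisElement := ⟨3/4, kn 1 2 1 2 1 1, {0, 1, 3, 4, 9}⟩
  let qt' : BasisElement := ⟨1/2, kn 1 2 1 2 1 1, {0, 1, 2, 3, 7}⟩
  ![[qa, qb, qe, qf, ql, qn, qr, qs],
    [qa, qb, qe, qf, ql, qo, qr, qs],
    [qa, qb, qe, qf, qg, ql, qr, qt],
    [qa, qb, qe, ql, qn, qq, qr, qs'],
    [qa, qb, qe, ql, qo, qq, qr, qs'],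
    [qa, qb, qe, qg', ql, qq, qr, qt']]

/-- The six bases: the symmetry classes of the representatives. -/
def basis (n : Fin 6) : Finset BasisElement :=
  (representatives n).toFinset.biUnion fun b => Finset.univ.image fun σ => b.sym σ

/-! ### The quasi-interpolant -/

/-- `L(f) = ∑_{k=1}^5 (k^5/5!) (-1)^(k-1) ∑ f((p_{r₁} + ⋯ + p_{r_k})/k)`, the inner sum being over
the `k`-element subfamilies of the family `P` of dual points. -/
noncomputable def coeffFunctional (P : Multiset Plane) (f : Plane → ℝ) : ℝ :=
  ∑ k ∈ Finset.Icc (1 : ℕ) 5, ((k : ℝ) ^ 5 / (Nat.factorial 5 : ℝ)) * (-1) ^ (k - 1) *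
    ((P.powersetCard k).map fun R => f ((k : ℝ)⁻¹ • R.sum)).sum

/-- The operator `Q(f) = ∑ L_i(f) S_i`, with `S_i = w_i Q[K_i]`, for the basis number `n`. -/
noncomputable def quasiInterpolant (v : Fin 3 → Plane) (ρ : Plane → Fin 12) (n : Fin 6)
    (f : Plane → ℝ) (x : Plane) : ℝ :=
  ∑ b ∈ basis n, coeffFunctional (b.dual.map (vertex v)) f *
    ((b.weight : ℝ) * simplexSpline v ρ b.knots x)

/-! ### Norms and Sobolev regularity -/

/-- The maximum norm on `A`, for functions continuous on a compact set `A`. -/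
noncomputable def supNorm (A : Set Plane) (f : Plane → ℝ) : ℝ :=
  sSup ((fun x => |f x|) '' A)

/-- The partial derivative in the `i`-th coordinate direction. -/
noncomputable def partialDeriv (i : Fin 2) (φ : Plane → ℝ) (x : Plane) : ℝ :=
  fderiv ℝ φ x (EuclideanSpace.single i 1)

/-- `g` is the weak partial derivative of `f` of multi-index `α` on the open set `U`. -/
def IsWeakDeriv (U : Set Plane) (α : ℕ × ℕ) (f g : Plane → ℝ) : Prop :=
  ∀ φ : Plane → ℝ, ContDiff ℝ ∞ φ → HasCompactSupport φ → tsupport φ ⊆ U →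
    ∫ x in U, f x * ((partialDeriv 0)^[α.1] ((partialDeriv 1)^[α.2] φ)) x =
      (-1) ^ (α.1 + α.2) * ∫ x in U, g x * φ x

/-- `f` lies in the Sobolev space `W^{m,∞}(U)`, with weak partial derivatives `g α`, `|α| ≤ m`. -/
def IsSobolevWith (U : Set Plane) (m : ℕ) (f : Plane → ℝ) (g : ℕ × ℕ → Plane → ℝ) : Prop :=
  ∀ α : ℕ × ℕ, α.1 + α.2 ≤ m → MemLp (g α) ∞ (volume.restrict U) ∧ IsWeakDeriv U α f (g α)

/-- `max_{|α| = m} ‖g α‖_{L∞(U)}`. -/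
noncomputable def sobolevSeminorm (U : Set Plane) (m : ℕ) (g : ℕ × ℕ → Plane → ℝ) : ℝ :=
  ((Finset.HasAntidiagonal.antidiagonal m).sup fun α => eLpNorm (g α) ∞ (volume.restrict U)).toReal

end PS12

open PS12

/-
On each of the 12 faces a basis element is a polynomial with integer coefficients in barycentric
coordinates. These pieces are computed exactly, and three properties of them are verified.
First, they differ from one polynomial by terms `qᵢ ℓᵢ⁴`, where `ℓᵢ = 0` are the six lines of the
split and `deg qᵢ ≤ 1`. So the basis element is `p + ∑ qᵢ max(ℓᵢ, 0)⁴`, which is `C³`.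
Second, the recursion may be carried out with a knot triangle that encloses the face, so that all
its coefficients are nonnegative there, and hence so is the basis element.
Third, the Marsden identity `∑ᵢ Sᵢ(x) ∏ₖ ℓ(p*ᵢₖ) = ℓ(x)⁵` holds for all affine functions `ℓ`. The
functional `Lᵢ` is a polarization formula, so `Lᵢ(ℓ⁵) = ∏ₖ ℓ(p*ᵢₖ)`, and the fifth powers of affine
functions span the quintics: `Q` reproduces them.
Finally, `ℓ = 1` shows that the `Sᵢ` form a partition of unity, so that the norm of `Q` is at most
`∑ₖ k⁵/5! · C(5, k) = 275/3`. Comparison of `f` with a Taylor polynomial gives the approximation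
order. As `f` has weak derivatives in the interior only, the Taylor polynomial is that of a
mollification, after a slight contraction of the triangle towards the center of expansion.
-/

namespace PS12

/-! ### Computable polynomials -/

/-- Polynomials with integer coefficients that the kernel can compute with: an element of the
iterated list type `List (⋯ (List ℤ))` with `n` layers is a polynomial in `n` variables, the
outermost list consisting of the coefficients of the powers of the first variable.  The second
argument of `eval` is the list of the values of the variables. -/
class NestedPoly (α : Type) where
  zero : α
  one : α
  add : α → α → α
  mul : α → α → α
  scale : ℤ → α → α
  isZero : α → Bool
  eval : α → List ℝ → ℝ
  eval_zero : ∀ e, eval zero e = 0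
  eval_one : ∀ e, eval one e = 1
  eval_add : ∀ p q e, eval (add p q) e = eval p e + eval q e
  eval_mul : ∀ p q e, eval (mul p q) e = eval p e * eval q e
  eval_scale : ∀ z p e, eval (scale z p) e = z * eval p e
  eval_of_isZero : ∀ p e, isZero p → eval p e = 0

instance : NestedPoly ℤ where
  zero := 0
  one := 1
  add := Int.add
  mul := Int.mul
  scale := Int.mul
  isZero z := match z with
    | Int.ofNat n => Nat.beq n 0
    | Int.negSucc _ => false
  eval z _ := z
  eval_zero _ := Int.cast_zero
  eval_one _ := Int.cast_one
  eval_add p q _ := Int.cast_add p q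
  eval_mul p q _ := Int.cast_mul p q
  eval_scale p q _ := Int.cast_mul p q
  eval_of_isZero p _ h := by cases p <;> simp_all

namespace NestedPoly

section Lists

variable {α : Type}

/-- The sum of two coefficient lists, with respect to the addition `f` of coefficients. -/
def addList (f : α → α → α) : List α → List α → List α
  | [], q => q
  | a :: p, [] => a :: p
  | a :: p, b :: q => f a b :: addList f p q

/-- The coefficient list of the product with the first variable.  The empty list is left alone, so
that no trailing zero coefficients pile up. -/
def shiftList (z : α) : List α → List α
  | [] => []
  | a :: p => z :: a :: p

/-- The product of two coefficient lists, with respect to the zero test `isZ`, the zero `z`, the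
addition `f` and the multiplication `g` of coefficients. -/
def mulList (isZ : α → Bool) (z : α) (f g : α → α → α) : List α → List α → List α
  | [], _ => []
  | a :: p, q =>
    addList f
      (match isZ a with
        | true => []
        | false => q.map (g a))
      (shiftList z (mulList isZ z f g p q))

variable [NestedPoly α]

/-- Evaluation by Horner's scheme in the first variable. -/
def evalList : List α → List ℝ → ℝ
  | [], _ => 0
  | a :: p, e => eval a e.tail + e.headD 0 * evalList p e

theorem evalList_addList (p q : List α) (e : List ℝ) :
    evalList (addList add p q) e = evalList p e + evalList q e := by
  induction p generalizing q with
  | nil => simp [addList, evalList]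
  | cons a p ih =>
    cases q with
    | nil => simp [addList, evalList]
    | cons b q => simp only [addList, evalList, eval_add, ih]; ring

theorem evalList_map (f : α → α) (c : ℝ) (e : List ℝ)
    (hf : ∀ a, eval (f a) e.tail = c * eval a e.tail) (p : List α) :
    evalList (p.map f) e = c * evalList p e := by
  induction p with
  | nil => simp [evalList]
  | cons a p ih => simp only [List.map_cons, evalList, hf, ih]; ring

theorem evalList_shiftList (p : List α) (e : List ℝ) :
    evalList (shiftList zero p) e = e.headD 0 * evalList p e := by
  cases p <;> simp [shiftList, evalList, eval_zero]

theorem evalList_of_all_isZero (p : List α) (e : List ℝ) (h : p.all isZero) :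
    evalList p e = 0 := by
  induction p with
  | nil => rfl
  | cons a p ih =>
    rw [List.all_cons, Bool.and_eq_true] at h
    simp [evalList, ih h.2, eval_of_isZero a _ h.1]

theorem evalList_mulList (p q : List α) (e : List ℝ) :
    evalList (mulList isZero zero add mul p q) e = evalList p e * evalList q e := by
  induction p with
  | nil => simp [mulList, evalList]
  | cons a p ih =>
    have head : evalList (match isZero a with
        | true => []
        | false => q.map (mul a)) e = eval a e.tail * evalList q e := by
      cases h : isZero a with
      | true => simp [evalList, eval_of_isZero a _ h]
      | false => exact evalList_map _ _ _ (fun b => eval_mul _ _ _) _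
    rw [mulList, evalList_addList, evalList_shiftList, head, evalList, ih]
    ring

instance : NestedPoly (List α) where
  zero := []
  one := [one]
  add := addList add
  mul := mulList isZero zero add mul
  scale z := List.map (scale z)
  isZero p := p.all isZero
  eval := evalList
  eval_zero _ := rfl
  eval_one _ := by simp [evalList, eval_one]
  eval_add := evalList_addList
  eval_mul := evalList_mulList
  eval_scale z p e := evalList_map (scale z) z e (fun a => eval_scale z a e.tail) p
  eval_of_isZero := evalList_of_all_isZero

theorem eval_nil (e : List ℝ) : eval ([] : List α) e = 0 := rfl

theorem eval_cons (a : α) (p : List α) (e : List ℝ) :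
    eval (a :: p) e = eval a e.tail + e.headD 0 * eval p e := rfl

end Lists

theorem eval_int (z : ℤ) (e : List ℝ) : eval z e = z := rfl

variable {α : Type} [NestedPoly α]

/-- The difference of two polynomials. -/
def sub (p q : α) : α := add p (scale (-1) q)

/-- Equality of polynomials, up to trailing zero coefficients. -/
def eqv (p q : α) : Bool := isZero (sub p q)

/-- Powers of a polynomial. -/
def pow (p : α) : ℕ → α
  | 0 => one
  | n + 1 => mul p (pow p n)

/-- The sum of a list of polynomials. -/
def sum (l : List α) : α := l.foldr add zero

/-- The product of a list of polynomials. -/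
def prod (l : List α) : α := l.foldr mul one

theorem eval_sub (p q : α) (e : List ℝ) : eval (sub p q) e = eval p e - eval q e := by
  rw [sub, eval_add, eval_scale]
  push_cast
  ring

theorem eval_eq_of_eqv {p q : α} (h : eqv p q) (e : List ℝ) : eval p e = eval q e :=
  sub_eq_zero.mp ((eval_sub p q e).symm.trans (eval_of_isZero _ e h))

theorem eval_pow (p : α) (n : ℕ) (e : List ℝ) : eval (pow p n) e = eval p e ^ n := by
  induction n with
  | zero => rw [pow, eval_one, pow_zero]
  | succ n ih => rw [pow, eval_mul, ih, pow_succ']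

theorem eval_sum (l : List α) (e : List ℝ) : eval (sum l) e = (l.map (eval · e)).sum := by
  induction l with
  | nil => exact eval_zero e
  | cons p l ih => rw [List.map_cons, List.sum_cons, ← ih]; exact eval_add _ _ e

theorem eval_prod (l : List α) (e : List ℝ) : eval (prod l) e = (l.map (eval · e)).prod := by
  induction l with
  | nil => exact eval_one e
  | cons p l ih => rw [List.map_cons, List.prod_cons, ← ih]; exact eval_mul _ _ e

end NestedPoly

open NestedPoly
open scoped Matrix

/-! ### The polynomial pieces of the simplex splines -/

/-- Polynomials in the last two barycentric coordinates of a point, or in two dual variables. -/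
abbrev BivariatePoly := List (List ℤ)

/-- Twelve times the barycentric coordinates of the vertices of the 12-split. -/
def bary12 : Fin 10 → Fin 3 → ℤ :=
  ![![12, 0, 0], ![0, 12, 0], ![0, 0, 12], ![6, 6, 0], ![0, 6, 6], ![6, 0, 6], ![6, 3, 3],
    ![3, 6, 3], ![3, 3, 6], ![4, 4, 4]]

/-- The signed area of the triangle spanned by three vertices of the 12-split, as a multiple of
`12⁻³` times the signed area of the macrotriangle. -/
def det12 (i j k : Fin 10) : ℤ := bary12 i ⬝ᵥ bary12 j ⨯₃ bary12 k

/-- The values at the three corners of the barycentric coordinate that belongs to the vertex `i` of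
the triangle spanned by the vertices `i, j, k`.  They are integers if `i, j, k < 6`. -/
def coord (i j k : Fin 10) (r : Fin 3) : ℤ := 12 * (bary12 j ⨯₃ bary12 k) r / det12 i j k

/-- The affine function with given values at the three corners. -/
def affine (f : Fin 3 → ℤ) : BivariatePoly := [[f 0, f 2 - f 0], [f 1 - f 0]]

/-- The affine function with the values `f` at the corners is nonnegative on the face `m`. -/
def nonnegOnFace (f : Fin 3 → ℤ) (m : Fin 12) : Bool :=
  ∀ r, 0 ≤ f ⬝ᵥ bary12 (faceVertices m r)

/-- The face `m` lies in the triangle spanned by the vertices `i, j, k`. -/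
def faceInTriangle (m : Fin 12) (i j k : Fin 10) : Bool :=
  nonnegOnFace (coord i j k) m && nonnegOnFace (coord j k i) m && nonnegOnFace (coord k i j) m

/-- The primes that encode the knots. -/
def knotPrime : Fin 10 → ℕ := ![2, 3, 5, 7, 11, 13, 17, 19, 23, 29]

/-- The Gödel number of a knot multiset: membership becomes divisibility by a prime, and removal of
a knot becomes division, which the kernel does fast. -/
def encode (K : Multiset (Fin 10)) : ℕ := (K.map knotPrime).prod

/-- The vertices of the triple are noncollinear knots of the multiset with Gödel number `c`. -/
def isKnotTriple (c : ℕ) (t : Fin 10 × Fin 10 × Fin 10) : Bool :=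
  c % knotPrime t.1 == 0 && c % knotPrime t.2.1 == 0 && c % knotPrime t.2.2 == 0 &&
    det12 t.1 t.2.1 t.2.2 != 0

/-- The triple chosen by `knotTriple`. -/
def firstTriple (c : ℕ) : Option (Fin 10 × Fin 10 × Fin 10) :=
  triples.find? (isKnotTriple c)

/-- The first triple of noncollinear knots whose triangle contains the face `m`. -/
def enclosingTriple (c : ℕ) (m : Fin 12) : Option (Fin 10 × Fin 10 × Fin 10) :=
  triples.find? fun t => isKnotTriple c t && faceInTriangle m t.1 t.2.1 t.2.2

/-- The combination of three of the polynomials `P`, with the barycentric coordinates with respect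
to the triple as coefficients. -/
def baryCombination (P : Fin 10 → BivariatePoly) : Fin 10 × Fin 10 × Fin 10 → BivariatePoly
  | (i, j, k) => add (mul (affine (coord i j k)) (P i))
      (add (mul (affine (coord j k i)) (P j)) (mul (affine (coord k i j)) (P k)))

-- The pattern `c + 1` makes the kernel evaluate the Gödel number before it unfolds `piece`, so that
-- equal pieces are recognized and computed only once.
/-- The polynomial that agrees on the face `m` with the simplex spline of degree `d` whose knot
multiset has the Gödel number `c`. -/
def piece : ℕ → ℕ → Fin 12 → BivariatePoly
  | _, 0, _ => []
  | 0, c + 1, m => match firstTriple (c + 1) with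
    | none => []
    | some (i, j, k) => if faceInTriangle m i j k then [[1728 / |det12 i j k|]] else []
  | d + 1, c + 1, m => match firstTriple (c + 1) with
    | none => []
    | some t => baryCombination (fun i => piece d ((c + 1) / knotPrime i) m) t

/-- The recursion for the piece on the face `m` may be carried out, down to degree `0`, with triples
that enclose `m`, so that all its coefficients are nonnegative on `m`. -/
def enclosingRecursion : ℕ → ℕ → Fin 12 → Bool
  | _, 0, _ => true
  | 0, _, _ => true
  | d + 1, c + 1, m => match enclosingTriple (c + 1) m with
    | none => isZero (piece (d + 1) (c + 1) m)
    | some (i, j, k) =>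
      eqv (piece (d + 1) (c + 1) m)
        (baryCombination (fun l => piece d ((c + 1) / knotPrime l) m) (i, j, k)) &&
      enclosingRecursion d ((c + 1) / knotPrime i) m &&
      enclosingRecursion d ((c + 1) / knotPrime j) m &&
      enclosingRecursion d ((c + 1) / knotPrime k) m

/-- The elements of the basis with number `n`, listed in a way that the kernel can evaluate. -/
def basisList (n : Fin 6) : List BasisElement :=
  ((representatives n).flatMap fun b =>
    (permsOfList (List.finRange 3)).map fun σ => b.sym σ).dedup

/-- The Gödel numbers of the knot multisets that occur in the six bases. -/
def knotCodes : List ℕ :=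
  ((List.finRange 6).flatMap fun n => (basisList n).map fun b => encode b.knots).dedup

/-! ### Truncated power representations -/

/-- The six lines of the split: the corner values of a linear form that vanishes on the line, and
two adjacent faces on its positive and its negative side. -/
def splitLine : Fin 6 → (Fin 3 → ℤ) × Fin 12 × Fin 12 := ![
  (![0, 1, -1], 8, 9), (![1, 0, -1], 11, 10), (![1, -1, 0], 10, 9), (![1, -1, -1], 0, 6),
  (![-1, 1, -1], 3, 8), (![-1, -1, 1], 4, 9)]

/-- The coefficient of `x₁ⁱ x₂ʲ`. -/
def coeffAt (p : BivariatePoly) (i j : ℕ) : ℤ := (p.getD i []).getD j 0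

/-- The polynomial `q` of degree at most one with `p = q ℓ⁴`, provided that there is one, where `ℓ`
is the linear form with corner values `f`.  By comparison of coefficients, for the forms in
`splitLine`: either `f 0 = ±1`, and the coefficients of order at most `1` determine `q`, or
`f = (0, 1, -1)`, and those of `x₁⁴`, `x₁⁵` and `x₂⁵` do. -/
def cofactor (f : Fin 3 → ℤ) (p : BivariatePoly) : BivariatePoly :=
  if f 0 = 0 then [[coeffAt p 4 0, coeffAt p 0 5], [coeffAt p 5 0]]
  else
    let a := coeffAt p 0 0
    [[a, coeffAt p 0 1 - 4 * a * f 0 * (f 2 - f 0)], [coeffAt p 1 0 - 4 * a * f 0 * (f 1 - f 0)]]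

/-- The quotient by `ℓ⁴` of the jump of the pieces `P` across the split line `ℓ = 0`. -/
def jumpCofactor (P : Fin 12 → BivariatePoly) (i : Fin 6) : BivariatePoly :=
  cofactor (splitLine i).1 (sub (P (splitLine i).2.1) (P (splitLine i).2.2))

/-- The polynomial `p + ∑ qᵢ ℓᵢ⁴` on the face `k`, where `p` is the piece on the face `9`, on which
all the forms `ℓᵢ` are nonpositive, and the sum is over the `ℓᵢ` that are nonnegative on `k`. -/
def truncatedPiece (P : Fin 12 → BivariatePoly) (k : Fin 12) : BivariatePoly :=
  add (P 9) (sum (((List.finRange 6).filter fun i => nonnegOnFace (splitLine i).1 k).map fun i =>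
    mul (jumpCofactor P i) (pow (affine (splitLine i).1) 4)))

/-- The pieces `P` are those of a sum of a polynomial and truncated powers. -/
def isTruncated (P : Fin 12 → BivariatePoly) : Bool :=
  (List.finRange 12).all fun k => eqv (P k) (truncatedPiece P k)

/-! ### The Marsden identity -/

/-- The linear form `w₀ + w₁ c₁ + w₂ c₂` in the dual variables `c₁, c₂`. -/
def dualLinear (w : Fin 3 → ℤ) : BivariatePoly := [[w 0, w 2], [w 1]]

/-- The product of the linear forms that belong to the dual points. -/
def dualPoly (D : Multiset (Fin 10)) : BivariatePoly :=
  prod ((List.finRange 10).map fun j => pow (dualLinear (bary12 j)) (D.count j))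

/-- The product `p(c₁, c₂) q(x₁, x₂)` of polynomials in separate variables. -/
def tensor (p q : BivariatePoly) : List (List BivariatePoly) :=
  p.map fun r => r.map fun z => scale z q

/-- The pairing `x₀ + c₁ x₁ + c₂ x₂`, where `x₀ = 1 - x₁ - x₂`. -/
def pairing : List (List BivariatePoly) := [[[[1, -1], [-1]], [[0, 1]]], [[[], [1]]]]

/-- Four times the weight of a basis element, which is an integer for the six bases. -/
def weight4 (b : BasisElement) : ℤ := b.weight.num * (4 / b.weight.den)

/-- The right-hand side of the Marsden identity on the face `k`. -/
def marsdenSum (n : Fin 6) (k : Fin 12) : List (List BivariatePoly) :=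
  sum ((basisList n).map fun b =>
    tensor (scale (weight4 b) (dualPoly b.dual)) (piece 5 (encode b.knots) k))

/-- The Marsden identity for the basis with number `n`. -/
def marsdenIdentity (n : Fin 6) : Bool :=
  (List.finRange 12).all fun k => eqv (marsdenSum n k) (scale (4 * 12 ^ 5) (pow pairing 5))

/-- The properties of the pieces that are left to the kernel. -/
def piecesCheck : Bool :=
  (knotCodes.all fun c => isTruncated (piece 5 c) &&
    (List.finRange 12).all fun m => enclosingRecursion 5 c m) &&
  (List.finRange 6).all marsdenIdentity

-- A single computation, because the kernel remembers the pieces within a declaration only.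
theorem piecesCheck_eq_true : piecesCheck = true := by
  decide +kernel

/-! ### Barycentric coordinates and areas -/

section Geometry

variable (b : AffineBasis (Fin 3) ℝ Plane)

theorem exists_affineBasis_coe_eq {v : Fin 3 → Plane} (hv : AffineIndependent ℝ v) :
    ∃ b : AffineBasis (Fin 3) ℝ Plane, ⇑b = v :=
  ⟨⟨v, hv, hv.affineSpan_eq_top_iff_card_eq_finrank_add_one.mpr (by simp)⟩, rfl⟩

theorem coords_sum (x : Plane) : b.coords x 0 + b.coords x 1 + b.coords x 2 = 1 := by
  rw [← b.sum_coord_apply_eq_one x, Fin.sum_univ_three]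
  rfl

theorem apply_eq_sum_coords (x : Plane) (i : Fin 2) :
    x i = b.coords x 0 * b 0 i + b.coords x 1 * b 1 i + b.coords x 2 * b 2 i := by
  conv_lhs => rw [← b.linear_combination_coord_eq_self x, Fin.sum_univ_three]
  rfl

theorem coords_sum_smul {w : Fin 3 → ℝ} (hw : ∑ r, w r = 1) : b.coords (∑ r, w r • b r) = w := by
  funext r
  rw [← Finset.univ.affineCombination_eq_linear_combination b w hw]
  exact b.coord_apply_combination_of_mem (Finset.mem_univ r) hw

theorem mem_triangle_iff (x : Plane) : x ∈ triangle b ↔ ∀ r, 0 ≤ b.coords x r := by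
  rw [triangle, b.convexHull_eq_nonneg_coord]
  rfl

theorem dotProduct_crossProduct (u v w : Fin 3 → ℝ) :
    u ⬝ᵥ v ⨯₃ w = u 0 * (v 1 * w 2 - v 2 * w 1) + u 1 * (v 2 * w 0 - v 0 * w 2) +
      u 2 * (v 0 * w 1 - v 1 * w 0) := by
  simp [cross_apply, dotProduct, Fin.sum_univ_three]

theorem orient_eq_det_coords (p q r : Plane) :
    orient p q r = (b.coords p ⬝ᵥ b.coords q ⨯₃ b.coords r) * orient (b 0) (b 1) (b 2) := by
  have hp : b.coords p 0 = 1 - b.coords p 1 - b.coords p 2 := by linarith [coords_sum b p]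
  have hq : b.coords q 0 = 1 - b.coords q 1 - b.coords q 2 := by linarith [coords_sum b q]
  have hr : b.coords r 0 = 1 - b.coords r 1 - b.coords r 2 := by linarith [coords_sum b r]
  simp only [orient, dotProduct_crossProduct, apply_eq_sum_coords b p, apply_eq_sum_coords b q,
    apply_eq_sum_coords b r, hp, hq, hr]
  ring

theorem orient_ne_zero : orient (b 0) (b 1) (b 2) ≠ 0 := by
  intro h
  have := orient_eq_det_coords b 0 !₂[1, 0] !₂[0, 1]
  rw [h, mul_zero] at this
  simp [orient] at this

theorem affineIndependent_of_orient_ne_zero {a b c : Plane} (h : orient a b c ≠ 0) :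
    AffineIndependent ℝ ![a, b, c] := by
  rw [affineIndependent_iff_of_fintype]
  intro w hw hz
  rw [Finset.univ.weightedVSub_eq_linear_combination hw] at hz
  have coordinate (i : Fin 2) : w 0 * a i + w 1 * b i + w 2 * c i = 0 := by
    simpa [Fin.sum_univ_three] using congrArg (fun y : Plane => y i) hz
  rw [Fin.sum_univ_three] at hw
  have h1 : w 1 = 0 := (mul_eq_zero.mp (by
    rw [orient]
    linear_combination (c 1 - a 1) * (coordinate 0 - a 0 * hw) -
      (c 0 - a 0) * (coordinate 1 - a 1 * hw) : w 1 * orient a b c = 0)).resolve_right h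
  have h2 : w 2 = 0 := (mul_eq_zero.mp (by
    rw [orient]
    linear_combination (b 0 - a 0) * (coordinate 1 - a 1 * hw) -
      (b 1 - a 1) * (coordinate 0 - a 0 * hw) : w 2 * orient a b c = 0)).resolve_right h
  have h0 : w 0 = 0 := by linarith
  intro i
  fin_cases i <;> assumption

theorem coords_eq_orient_div (x : Plane) : b.coords x =
    ![orient x (b 1) (b 2) / orient (b 0) (b 1) (b 2),
      orient (b 0) x (b 2) / orient (b 0) (b 1) (b 2),
      orient (b 0) (b 1) x / orient (b 0) (b 1) (b 2)] := by
  have corner (r : Fin 3) : b.coords (b r) = Pi.single r 1 := by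
    funext s
    rw [b.coords_apply, b.coord_apply, Pi.single_apply]
  have hD := orient_ne_zero b
  funext r
  fin_cases r <;>
    simp [-AffineBasis.coords_apply, orient_eq_det_coords b _ _ x, orient_eq_det_coords b _ x _,
      orient_eq_det_coords b x, dotProduct_crossProduct, -single_dotProduct, corner, hD]

theorem mem_triangle_iff_orient_div {p q r : Plane} (h : orient p q r ≠ 0) (x : Plane) :
    x ∈ triangle ![p, q, r] ↔ 0 ≤ orient x q r / orient p q r ∧ 0 ≤ orient p x r / orient p q r ∧
      0 ≤ orient p q x / orient p q r := by
  obtain ⟨w, hw⟩ := exists_affineBasis_coe_eq (affineIndependent_of_orient_ne_zero h)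
  rw [← hw, mem_triangle_iff, coords_eq_orient_div, hw]
  simp [Fin.forall_fin_succ]

/-- The linear map with the columns `p` and `q`. -/
noncomputable def columnMap (p q : Plane) : Plane →ₗ[ℝ] Plane :=
  Matrix.toLin (EuclideanSpace.basisFun (Fin 2) ℝ).toBasis
    (EuclideanSpace.basisFun (Fin 2) ℝ).toBasis !![p 0, q 0; p 1, q 1]

theorem columnMap_apply (p q x : Plane) : columnMap p q x = x 0 • p + x 1 • q := by
  ext i
  fin_cases i <;>
    simp [columnMap, Matrix.toLin_apply, Matrix.mulVec, dotProduct, Fin.sum_univ_two] <;> ring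

theorem det_columnMap (p q : Plane) : LinearMap.det (columnMap p q) = p 0 * q 1 - p 1 * q 0 := by
  simp only [columnMap, LinearMap.det_toLin, Matrix.det_fin_two_of]
  ring

/-- The triangle with the corners `0`, `(1, 0)` and `(0, 1)`, the unit of area. -/
noncomputable def standardTriangle : Set Plane := triangle ![0, !₂[1, 0], !₂[0, 1]]

theorem triangle_eq_image (p q r : Plane) :
    triangle ![p, q, r] = (p + ·) '' (columnMap (q - p) (r - p) '' standardTriangle) := by
  rw [standardTriangle, triangle, triangle, LinearMap.image_convexHull, ← Set.range_comp]
  have h := (AffineEquiv.constVAdd ℝ Plane p).toAffineMap.image_convexHull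
    (Set.range (columnMap (q - p) (r - p) ∘ ![0, !₂[1, 0], !₂[0, 1]]))
  refine Eq.trans ?_ h.symm
  rw [← Set.range_comp]
  congr 2
  funext i
  fin_cases i <;> simp [columnMap_apply]

theorem area_triangle (p q r : Plane) :
    area (triangle ![p, q, r]) = |orient p q r| * area standardTriangle := by
  rw [area, triangle_eq_image, Set.image_add_left, measure_preimage_add,
    Measure.addHaar_image_linearMap, det_columnMap, ENNReal.toReal_mul,
    ENNReal.toReal_ofReal (abs_nonneg _), area]
  rfl

theorem isCompact_triangle (v : Fin 3 → Plane) : IsCompact (triangle v) :=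
  (Set.finite_range v).isCompact_convexHull (𝕜 := ℝ)

theorem coe_affineBasis_eq : ![b 0, b 1, b 2] = b := by
  funext i
  fin_cases i <;> rfl

theorem interior_triangle_nonempty : (interior (triangle b)).Nonempty :=
  interior_convexHull_nonempty_iff_affineSpan_eq_top.mpr b.tot

theorem area_standardTriangle_ne_zero : area standardTriangle ≠ 0 := by
  have hD : orient 0 !₂[1, 0] !₂[0, 1] ≠ 0 := by simp [orient]
  obtain ⟨b, hb⟩ := exists_affineBasis_coe_eq (affineIndependent_of_orient_ne_zero hD)
  rw [standardTriangle, ← hb]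
  exact (ENNReal.toReal_pos (Measure.measure_pos_of_nonempty_interior volume
    (interior_triangle_nonempty b)).ne' (isCompact_triangle b).measure_lt_top.ne).ne'

theorem exists_orient_ne_zero {s : Set Plane} (h : area (convexHull ℝ s) ≠ 0) :
    ∃ a ∈ s, ∃ b ∈ s, ∃ c ∈ s, orient a b c ≠ 0 := by
  have hs : affineSpan ℝ s = ⊤ := by
    by_contra hs
    refine h ?_
    rw [area, measure_mono_null (convexHull_subset_affineSpan s)
      (Measure.addHaar_affineSubspace volume _ hs), ENNReal.toReal_zero]
  obtain ⟨t, hts, hspan, ht⟩ := exists_affineIndependent ℝ Plane s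
  have := finite_of_fin_dim_affineIndependent ℝ ht
  have := Fintype.ofFinite t
  have hcard : Fintype.card t = 3 := by
    rw [(ht.affineSpan_eq_top_iff_card_eq_finrank_add_one).mp
      (by rw [Subtype.range_coe, hspan, hs]), finrank_euclideanSpace_fin]
  let e : Fin 3 ≃ t := (Fintype.equivFinOfCardEq hcard).symm
  obtain ⟨b, hb⟩ := exists_affineBasis_coe_eq (ht.comp_embedding e.toEmbedding)
  have mem (i : Fin 3) : b i ∈ s := hb ▸ hts (e i).2
  exact ⟨b 0, mem 0, b 1, mem 1, b 2, mem 2, orient_ne_zero b⟩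

end Geometry

/-! ### The simplex splines and their pieces -/

section Pieces

theorem coord_mul_det12 : ∀ i j k : Fin 10, i < 6 → j < 6 → k < 6 → det12 i j k ≠ 0 →
    ∀ r, coord i j k r * det12 i j k = 12 * (bary12 j ⨯₃ bary12 k) r := by
  decide +kernel

theorem det12_dvd : ∀ i j k : Fin 10, i < 6 → j < 6 → k < 6 → det12 i j k ≠ 0 →
    |det12 i j k| ∣ 1728 := by
  decide +kernel

theorem sum_bary12 : ∀ j : Fin 10, ∑ r, bary12 j r = 12 := by
  decide

theorem det12_rotate : ∀ i j k : Fin 10, det12 j k i = det12 i j k := by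
  decide +kernel

variable (b : AffineBasis (Fin 3) ℝ Plane)

theorem coords_vertex (j : Fin 10) : b.coords (vertex b j) = fun r => (bary12 j r : ℝ) / 12 := by
  have combination : vertex b j = ∑ r, ((bary12 j r : ℝ) / 12) • b r := by
    rw [Fin.sum_univ_three]
    fin_cases j <;> simp [vertex, bary12] <;> module
  rw [combination]
  refine coords_sum_smul b ?_
  rw [← Finset.sum_div, ← Int.cast_sum, sum_bary12]
  norm_num

theorem orient_vertex (i j k : Fin 10) : orient (vertex b i) (vertex b j) (vertex b k) =
    det12 i j k / 1728 * orient (b 0) (b 1) (b 2) := by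
  rw [orient_eq_det_coords b, coords_vertex, coords_vertex, coords_vertex, dotProduct_crossProduct]
  simp only [det12, cross_apply, dotProduct, Fin.sum_univ_three, Matrix.cons_val]
  push_cast
  ring

theorem orient_vertex_ne_zero_iff (i j k : Fin 10) :
    orient (vertex b i) (vertex b j) (vertex b k) ≠ 0 ↔ det12 i j k ≠ 0 := by
  simp [orient_vertex, orient_ne_zero b]

/-- The affine function with the values `f` at the corners. -/
noncomputable def affineForm (f : Fin 3 → ℤ) : Plane →ᵃ[ℝ] ℝ := ∑ r, (f r : ℝ) • b.coord r

theorem affineForm_apply (f : Fin 3 → ℤ) (x : Plane) : affineForm b f x =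
    f 0 * b.coords x 0 + f 1 * b.coords x 1 + f 2 * b.coords x 2 := by
  simp [affineForm, Fin.sum_univ_three]

theorem affineForm_vertex (f : Fin 3 → ℤ) (j : Fin 10) :
    affineForm b f (vertex b j) = (f ⬝ᵥ bary12 j : ℤ) / 12 := by
  rw [affineForm_apply, coords_vertex, dotProduct, Fin.sum_univ_three]
  push_cast
  ring

theorem nonnegOnFace_iff (f : Fin 3 → ℤ) (m : Fin 12) :
    nonnegOnFace f m ↔ ∀ x ∈ face b m, 0 ≤ affineForm b f x := by
  have atVertex (j : Fin 10) : 0 ≤ affineForm b f (vertex b j) ↔ 0 ≤ f ⬝ᵥ bary12 j := by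
    rw [affineForm_vertex, le_div_iff₀ (by norm_num), zero_mul, Int.cast_nonneg_iff]
  rw [nonnegOnFace, decide_eq_true_iff]
  constructor
  · intro h
    refine convexHull_min ?_ ((convex_Ici 0).affine_preimage (affineForm b f))
    rintro _ ⟨r, rfl⟩
    exact (atVertex _).mpr (h r)
  · exact fun h r => (atVertex _).mp (h _ (subset_convexHull ℝ _ (Set.mem_range_self r)))

theorem affineForm_coord {i j k : Fin 10} (hi : i < 6) (hj : j < 6) (hk : k < 6)
    (h : det12 i j k ≠ 0) (x : Plane) : affineForm b (coord i j k) x =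
      orient x (vertex b j) (vertex b k) / orient (vertex b i) (vertex b j) (vertex b k) := by
  have hD : (det12 i j k : ℝ) ≠ 0 := by exact_mod_cast h
  have hcoord (r : Fin 3) : (coord i j k r : ℝ) =
      12 * ((bary12 j ⨯₃ bary12 k) r : ℤ) / det12 i j k := by
    rw [eq_div_iff hD]
    exact_mod_cast coord_mul_det12 i j k hi hj hk h r
  rw [orient_vertex, orient_eq_det_coords b, coords_vertex, coords_vertex,
    dotProduct_crossProduct, affineForm_apply, hcoord, hcoord, hcoord,
    mul_div_mul_right _ _ (orient_ne_zero b)]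
  simp only [cross_apply, Matrix.cons_val]
  push_cast
  field_simp
  ring

theorem affineForm_coords {i j k : Fin 10} (hi : i < 6) (hj : j < 6) (hk : k < 6)
    (h : det12 i j k ≠ 0) (x : Plane) :
    affineForm b (coord i j k) x =
      orient x (vertex b j) (vertex b k) / orient (vertex b i) (vertex b j) (vertex b k) ∧
    affineForm b (coord j k i) x =
      orient (vertex b i) x (vertex b k) / orient (vertex b i) (vertex b j) (vertex b k) ∧
    affineForm b (coord k i j) x =
      orient (vertex b i) (vertex b j) x / orient (vertex b i) (vertex b j) (vertex b k) := by
  have rotate (p q r : Plane) : orient p q r = orient q r p := by simp only [orient]; ring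
  refine ⟨affineForm_coord b hi hj hk h x, ?_, ?_⟩
  · rw [affineForm_coord b hj hk hi (by rwa [det12_rotate]), rotate (vertex b i) x,
      rotate (vertex b i)]
  · rw [affineForm_coord b hk hi hj (by rwa [← det12_rotate]), rotate x,
      rotate (vertex b k)]

theorem faceInTriangle_iff {i j k : Fin 10} (hi : i < 6) (hj : j < 6) (hk : k < 6)
    (h : det12 i j k ≠ 0) (m : Fin 12) : faceInTriangle m i j k ↔
      face b m ⊆ triangle ![vertex b i, vertex b j, vertex b k] := by
  simp only [faceInTriangle, Bool.and_eq_true, nonnegOnFace_iff b, ← forall_and, Set.subset_def,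
    mem_triangle_iff_orient_div ((orient_vertex_ne_zero_iff b i j k).mpr h),
    affineForm_coords b hi hj hk h, and_assoc]

end Pieces

section Recursion

theorem prime_knotPrime : ∀ i, (knotPrime i).Prime := by
  decide +kernel

theorem knotPrime_injective : Function.Injective knotPrime := by
  decide

theorem encode_ne_zero (K : Multiset (Fin 10)) : encode K ≠ 0 := by
  simp [encode, Multiset.prod_eq_zero_iff, (prime_knotPrime _).ne_zero]

theorem knotPrime_dvd_encode_iff {i : Fin 10} {K : Multiset (Fin 10)} :
    knotPrime i ∣ encode K ↔ i ∈ K := by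
  refine ⟨fun h => ?_, fun h => Multiset.dvd_prod (Multiset.mem_map_of_mem _ h)⟩
  obtain ⟨j, hj, hij⟩ := (prime_knotPrime i).prime.exists_mem_multiset_map_dvd h
  rwa [knotPrime_injective ((Nat.prime_dvd_prime_iff_eq (prime_knotPrime i)
    (prime_knotPrime j)).mp hij)]

theorem encode_div_knotPrime {i : Fin 10} {K : Multiset (Fin 10)} (h : i ∈ K) :
    encode K / knotPrime i = encode (K.erase i) := by
  rw [encode, ← Multiset.prod_map_erase h, Nat.mul_div_cancel_left _ (prime_knotPrime i).pos,
    encode]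

theorem isKnotTriple_encode {K : Multiset (Fin 10)} {t : Fin 10 × Fin 10 × Fin 10} :
    isKnotTriple (encode K) t ↔
      t.1 ∈ K ∧ t.2.1 ∈ K ∧ t.2.2 ∈ K ∧ det12 t.1 t.2.1 t.2.2 ≠ 0 := by
  simp [isKnotTriple, ← Nat.dvd_iff_mod_eq_zero, knotPrime_dvd_encode_iff, and_assoc]

theorem knotTriple_eq_firstTriple (b : AffineBasis (Fin 3) ℝ Plane) (K : Multiset (Fin 10)) :
    knotTriple b K = firstTriple (encode K) := by
  refine congrArg (fun p => triples.find? p) (funext fun t => Bool.eq_iff_iff.mpr ?_)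
  rw [decide_eq_true_iff, isKnotTriple_encode, orient_vertex_ne_zero_iff]

theorem exists_mem_triples : ∀ i j k : Fin 10, det12 i j k ≠ 0 →
    ∃ t ∈ triples, (t.1 ∈ [i, j, k] ∧ t.2.1 ∈ [i, j, k] ∧ t.2.2 ∈ [i, j, k]) ∧
      det12 t.1 t.2.1 t.2.2 ≠ 0 := by
  decide +kernel

theorem lt_of_mem_triples {t : Fin 10 × Fin 10 × Fin 10} (h : t ∈ triples) :
    t.1 < t.2.1 ∧ t.2.1 < t.2.2 := by
  simpa using (List.mem_filter.mp h).2

variable {b : AffineBasis (Fin 3) ℝ Plane} {K : Multiset (Fin 10)}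

theorem hull_triple (v : Fin 3 → Plane) (i j k : Fin 10) :
    hull v {i, j, k} = triangle ![vertex v i, vertex v j, vertex v k] := by
  rw [hull, triangle]
  congr 1
  have knots : {l | l ∈ ({i, j, k} : Multiset (Fin 10))} = Set.range ![i, j, k] := by
    ext l
    simp [-Matrix.range_cons, eq_comm, Fin.exists_fin_succ]
  rw [knots, ← Set.range_comp]
  congr 1
  funext r
  fin_cases r <;> rfl

theorem area_hull_eq_zero (h : firstTriple (encode K) = none) : area (hull b K) = 0 := by
  by_contra hne
  obtain ⟨_, ⟨i, hi, rfl⟩, _, ⟨j, hj, rfl⟩, _, ⟨k, hk, rfl⟩, hD⟩ := exists_orient_ne_zero hne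
  obtain ⟨t, ht, ⟨h1, h2, h3⟩, hdet⟩ :=
    exists_mem_triples i j k ((orient_vertex_ne_zero_iff b i j k).mp hD)
  have mem {l : Fin 10} (hl : l ∈ [i, j, k]) : l ∈ K := by
    simp only [List.mem_cons, List.not_mem_nil, or_false] at hl
    rcases hl with rfl | rfl | rfl <;> assumption
  exact List.find?_eq_none.mp h t ht (isKnotTriple_encode.mpr ⟨mem h1, mem h2, mem h3, hdet⟩)

theorem area_hull_ne_zero {i j k : Fin 10} (hi : i ∈ K) (hj : j ∈ K) (hk : k ∈ K)
    (h : det12 i j k ≠ 0) : area (hull b K) ≠ 0 := by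
  have hsub : hull b {i, j, k} ⊆ hull b K := by
    refine convexHull_mono (Set.image_mono fun l hl => ?_)
    simp only [Multiset.insert_eq_cons, Multiset.mem_cons, Multiset.mem_singleton,
      Set.mem_ofPred_eq] at hl
    rcases hl with rfl | rfl | rfl <;> assumption
  have hfinite : volume (hull b K) ≠ ⊤ :=
    ((K.toFinset.finite_toSet.subset fun l hl => Multiset.mem_toFinset.mpr hl).image
      (vertex b)).isCompact_convexHull (𝕜 := ℝ) |>.measure_lt_top.ne
  have hpos : area (hull b {i, j, k}) ≠ 0 := by
    rw [hull_triple, area_triangle]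
    exact mul_ne_zero (abs_ne_zero.mpr ((orient_vertex_ne_zero_iff b i j k).mpr h))
      area_standardTriangle_ne_zero
  exact ((ENNReal.toReal_nonneg.lt_of_ne' hpos).trans_le
    (ENNReal.toReal_mono hfinite (measure_mono hsub))).ne'

theorem area_triangle_div_area_hull {i j k : Fin 10} (hi : i < 6) (hj : j < 6) (hk : k < 6)
    (h : det12 i j k ≠ 0) :
    area (triangle b) / area (hull b {i, j, k}) = (1728 / |det12 i j k| : ℤ) := by
  have hD : ((|det12 i j k| : ℤ) : ℝ) ≠ 0 := by exact_mod_cast abs_ne_zero.mpr h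
  rw [hull_triple, ← coe_affineBasis_eq b, area_triangle, area_triangle, coe_affineBasis_eq,
    orient_vertex, abs_mul, abs_div, mul_div_mul_right _ _ area_standardTriangle_ne_zero,
    Int.cast_div (det12_dvd i j k hi hj hk h) hD, div_mul_cancel_right₀
    (abs_ne_zero.mpr (orient_ne_zero b)), Int.cast_abs]
  norm_num

/-- The values of the variables of the pieces at `x`. -/
noncomputable def vars (b : AffineBasis (Fin 3) ℝ Plane) (x : Plane) : List ℝ :=
  [b.coords x 1, b.coords x 2]

theorem eval_const (z : ℤ) (e : List ℝ) : eval ([[z]] : BivariatePoly) e = z := by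
  simp [eval_cons, eval_nil, eval_int]

theorem eval_affine (f : Fin 3 → ℤ) (x : Plane) :
    eval (affine f) (vars b x) = affineForm b f x := by
  rw [affineForm_apply, eq_sub_of_add_eq (eq_sub_of_add_eq (coords_sum b x))]
  simp only [affine, eval_cons, eval_nil, eval_int, vars, List.tail_cons, List.headD_cons]
  push_cast
  ring

theorem eval_baryCombination (P : Fin 10 → BivariatePoly) (i j k : Fin 10) (x : Plane) :
    eval (baryCombination P (i, j, k)) (vars b x) =
      affineForm b (coord i j k) x * eval (P i) (vars b x) +
      affineForm b (coord j k i) x * eval (P j) (vars b x) +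
      affineForm b (coord k i j) x * eval (P k) (vars b x) := by
  simp only [baryCombination, eval_add, eval_mul, eval_affine, add_assoc]

theorem piece_of_none (d : ℕ) (m : Fin 12) (h : firstTriple (encode K) = none) :
    piece d (encode K) m = [] := by
  obtain ⟨c, hc⟩ := Nat.exists_eq_succ_of_ne_zero (encode_ne_zero K)
  rw [hc] at h ⊢
  cases d <;> simp [piece, h]

theorem piece_zero_of_some {i j k : Fin 10} (m : Fin 12)
    (h : firstTriple (encode K) = some (i, j, k)) :
    piece 0 (encode K) m = if faceInTriangle m i j k then [[1728 / |det12 i j k|]] else [] := by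
  obtain ⟨c, hc⟩ := Nat.exists_eq_succ_of_ne_zero (encode_ne_zero K)
  rw [hc] at h ⊢
  simp [piece, h]

theorem piece_succ_of_some {t : Fin 10 × Fin 10 × Fin 10} (d : ℕ) (m : Fin 12)
    (h : firstTriple (encode K) = some t) : piece (d + 1) (encode K) m =
      baryCombination (fun i => piece d (encode K / knotPrime i) m) t := by
  obtain ⟨c, hc⟩ := Nat.exists_eq_succ_of_ne_zero (encode_ne_zero K)
  rw [hc] at h ⊢
  simp [piece, h]

theorem firstTriple_mem {i j k : Fin 10} (h : firstTriple (encode K) = some (i, j, k)) :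
    i ∈ K ∧ j ∈ K ∧ k ∈ K ∧ det12 i j k ≠ 0 :=
  isKnotTriple_encode.mp (List.find?_some h)

theorem eq_of_firstTriple {i j k : Fin 10} (hcard : K.card = 3)
    (h : firstTriple (encode K) = some (i, j, k)) : K = {i, j, k} := by
  obtain ⟨hi, hj, hk, -⟩ := firstTriple_mem h
  obtain ⟨hij, hjk⟩ := lt_of_mem_triples (List.mem_of_find?_eq_some h)
  have hnodup : ({i, j, k} : Multiset (Fin 10)).Nodup := by
    simp [hij.ne, hjk.ne, (hij.trans hjk).ne]
  refine (Multiset.eq_of_le_of_card_le ((Multiset.le_iff_subset hnodup).mpr fun l hl => ?_)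
    (by simp [hcard])).symm
  simp only [Multiset.insert_eq_cons, Multiset.mem_cons, Multiset.mem_singleton] at hl
  rcases hl with rfl | rfl | rfl <;> assumption

variable {ρ : Plane → Fin 12} {x : Plane}

theorem mem_halfOpenHull_iff (hx : x ∈ face b (ρ x)) :
    x ∈ halfOpenHull b ρ K ↔ face b (ρ x) ⊆ hull b K := by
  simp only [halfOpenHull, halfOpenFace, Set.mem_iUnion, Set.mem_ofPred_eq]
  constructor
  · rintro ⟨k, hk, -, rfl⟩
    exact hk
  · exact fun h => ⟨ρ x, h, hx, rfl⟩

theorem simplexSplineAux_zero (hx : x ∈ face b (ρ x)) (hK : ∀ j ∈ K, j < 6) (hcard : K.card = 3) :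
    simplexSplineAux b ρ 0 K x = eval (piece 0 (encode K) (ρ x)) (vars b x) := by
  classical
  rw [simplexSplineAux]
  cases h : firstTriple (encode K) with
  | none => rw [if_pos (area_hull_eq_zero h), piece_of_none 0 _ h, eval_nil]
  | some t =>
    obtain ⟨i, j, k⟩ := t
    obtain ⟨hi, hj, hk, hdet⟩ := firstTriple_mem h
    rw [if_neg (area_hull_ne_zero hi hj hk hdet), piece_zero_of_some _ h, Set.indicator_apply]
    rw [apply_ite (eval · (vars b x)), eval_nil]
    refine if_congr ?_ ?_ rfl
    · rw [mem_halfOpenHull_iff hx, faceInTriangle_iff b (hK i hi) (hK j hj) (hK k hk) hdet,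
        eq_of_firstTriple hcard h, hull_triple]
    · rw [eval_const, ← area_triangle_div_area_hull (hK i hi) (hK j hj) (hK k hk) hdet,
        eq_of_firstTriple hcard h]

theorem simplexSplineAux_eq_eval_piece (hx : x ∈ face b (ρ x)) (d : ℕ) (hK : ∀ j ∈ K, j < 6)
    (hcard : K.card = d + 3) :
    simplexSplineAux b ρ d K x = eval (piece d (encode K) (ρ x)) (vars b x) := by
  induction d generalizing K with
  | zero => exact simplexSplineAux_zero hx hK hcard
  | succ d ih =>
    have erase {i : Fin 10} (hi : i ∈ K) : simplexSplineAux b ρ d (K.erase i) x =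
        eval (piece d (encode K / knotPrime i) (ρ x)) (vars b x) := by
      rw [encode_div_knotPrime hi]
      exact ih (fun j hj => hK j (Multiset.mem_of_mem_erase hj)) (by
        rw [Multiset.card_erase_of_mem hi, hcard]; rfl)
    rw [simplexSplineAux, knotTriple_eq_firstTriple]
    cases h : firstTriple (encode K) with
    | none => rw [if_pos (area_hull_eq_zero h), piece_of_none _ _ h, eval_nil]
    | some t =>
      obtain ⟨i, j, k⟩ := t
      obtain ⟨hi, hj, hk, hdet⟩ := firstTriple_mem h
      obtain ⟨ei, ej, ek⟩ := affineForm_coords b (hK i hi) (hK j hj) (hK k hk) hdet x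
      rw [if_neg (area_hull_ne_zero hi hj hk hdet), piece_succ_of_some _ _ h,
        eval_baryCombination, ei, ej, ek, ← erase hi, ← erase hj, ← erase hk]

end Recursion

theorem isTruncated_piece {c : ℕ} (hc : c ∈ knotCodes) : isTruncated (piece 5 c) := by
  have h := piecesCheck_eq_true
  rw [piecesCheck, Bool.and_eq_true, List.all_eq_true] at h
  exact (Bool.and_eq_true _ _ ▸ h.1 c hc).1

theorem enclosingRecursion_piece {c : ℕ} (hc : c ∈ knotCodes) (m : Fin 12) :
    enclosingRecursion 5 c m := by
  have h := piecesCheck_eq_true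
  rw [piecesCheck, Bool.and_eq_true, List.all_eq_true] at h
  exact List.all_eq_true.mp (Bool.and_eq_true _ _ ▸ h.1 c hc).2 m (List.mem_finRange m)

theorem eqv_marsdenSum (n : Fin 6) (k : Fin 12) :
    eqv (marsdenSum n k) (scale (4 * 12 ^ 5) (pow pairing 5)) := by
  have h := piecesCheck_eq_true
  rw [piecesCheck, Bool.and_eq_true] at h
  exact List.all_eq_true.mp (List.all_eq_true.mp h.2 n (List.mem_finRange n)) k
    (List.mem_finRange k)

section Basis

theorem toFinset_basisList (n : Fin 6) : (basisList n).toFinset = basis n := by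
  ext s
  have mem (σ : Equiv.Perm (Fin 3)) : σ ∈ permsOfList (List.finRange 3) :=
    mem_permsOfList_iff.mpr fun _ => List.mem_finRange _
  simp [basisList, basis, mem]

theorem encode_mem_knotCodes {n : Fin 6} {s : BasisElement} (hs : s ∈ basis n) :
    encode s.knots ∈ knotCodes := by
  rw [← toFinset_basisList, List.mem_toFinset] at hs
  exact List.mem_dedup.mpr (List.mem_flatMap.mpr
    ⟨n, List.mem_finRange n, List.mem_map_of_mem hs⟩)

theorem knots_dual_weight_of_mem_basisList : ∀ n, ∀ s ∈ basisList n,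
    s.knots.card = 8 ∧ (∀ j ∈ s.knots, j < 6) ∧ s.dual.card = 5 ∧ 0 ≤ s.weight ∧
      (weight4 s : ℚ) = 4 * s.weight := by
  decide +kernel

theorem knots_dual_weight_of_mem_basis {n : Fin 6} {s : BasisElement} (hs : s ∈ basis n) :
    s.knots.card = 8 ∧ (∀ j ∈ s.knots, j < 6) ∧ s.dual.card = 5 ∧ 0 ≤ s.weight ∧
      (weight4 s : ℚ) = 4 * s.weight := by
  rw [← toFinset_basisList, List.mem_toFinset] at hs
  exact knots_dual_weight_of_mem_basisList n s hs

end Basis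

section Nonnegativity

variable {b : AffineBasis (Fin 3) ℝ Plane} {x : Plane} {m : Fin 12}

theorem affineForm_nonneg_of_faceInTriangle {i j k : Fin 10} (h : faceInTriangle m i j k)
    (hx : x ∈ face b m) : 0 ≤ affineForm b (coord i j k) x ∧ 0 ≤ affineForm b (coord j k i) x ∧
      0 ≤ affineForm b (coord k i j) x := by
  simp only [faceInTriangle, Bool.and_eq_true, and_assoc, nonnegOnFace_iff b] at h
  exact ⟨h.1 x hx, h.2.1 x hx, h.2.2 x hx⟩

theorem eval_piece_zero_nonneg (c : ℕ) (m : Fin 12) (e : List ℝ) : 0 ≤ eval (piece 0 c m) e := by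
  cases c with
  | zero => rw [piece, eval_nil]
  | succ c =>
    rw [piece]
    split
    · rw [eval_nil]
    · split_ifs
      · rw [eval_const]
        exact_mod_cast Int.ediv_nonneg (by norm_num) (abs_nonneg _)
      · rw [eval_nil]

theorem eval_piece_nonneg (hx : x ∈ face b m) (d c : ℕ) (h : enclosingRecursion d c m) :
    0 ≤ eval (piece d c m) (vars b x) := by
  induction d generalizing c with
  | zero => exact eval_piece_zero_nonneg c m _
  | succ d ih =>
    cases c with
    | zero => rw [piece, eval_nil]
    | succ c =>
      rw [enclosingRecursion] at h
      split at h
      · exact (eval_of_isZero _ _ h).ge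
      · rename_i i j k htriple
        simp only [Bool.and_eq_true, and_assoc] at h
        obtain ⟨heq, hi, hj, hk⟩ := h
        have hin := (Bool.and_eq_true _ _ ▸ List.find?_some htriple).2
        obtain ⟨ci, cj, ck⟩ := affineForm_nonneg_of_faceInTriangle hin hx
        rw [eval_eq_of_eqv heq, eval_baryCombination]
        exact add_nonneg (add_nonneg (mul_nonneg ci (ih _ hi)) (mul_nonneg cj (ih _ hj)))
          (mul_nonneg ck (ih _ hk))

theorem simplexSpline_nonneg {ρ : Plane → Fin 12} {n : Fin 6} {s : BasisElement}
    (hs : s ∈ basis n) (hx : x ∈ face b (ρ x)) : 0 ≤ simplexSpline b ρ s.knots x := by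
  obtain ⟨hcard, hlt, -⟩ := knots_dual_weight_of_mem_basis hs
  rw [simplexSpline, hcard, simplexSplineAux_eq_eval_piece hx 5 hlt hcard]
  exact eval_piece_nonneg hx 5 _ (enclosingRecursion_piece (encode_mem_knotCodes hs) _)

end Nonnegativity

section Marsden

theorem eval_map_scale (r : List ℤ) (q : BivariatePoly) (c : ℝ) (e : List ℝ) :
    eval (r.map fun z => scale z q) (c :: e) = eval r [c] * eval q e := by
  induction r with
  | nil => simp [eval_nil]
  | cons z r ih =>
    simp only [List.map_cons, eval_cons, List.tail_cons, List.headD_cons, eval_scale, eval_int, ih]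
    ring

theorem eval_tensor (p q : BivariatePoly) (c₁ c₂ : ℝ) (e : List ℝ) :
    eval (tensor p q) (c₁ :: c₂ :: e) = eval p [c₁, c₂] * eval q e := by
  induction p with
  | nil => simp [tensor, eval_nil]
  | cons r p ih =>
    simp only [tensor, List.map_cons, eval_cons, List.tail_cons, List.headD_cons,
      eval_map_scale] at ih ⊢
    rw [ih]
    ring

theorem eval_dualPoly (D : Multiset (Fin 10)) (e : List ℝ) :
    eval (dualPoly D) e = (D.map fun j => eval (dualLinear (bary12 j)) e).prod := by
  rw [dualPoly, eval_prod, List.map_map, ← Fin.prod_univ_def, Finset.prod_multiset_map_count]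
  refine Eq.trans (Finset.prod_congr rfl fun j _ => eval_pow _ _ e)
    (Finset.prod_subset (Finset.subset_univ _) fun j _ hj => ?_).symm
  rw [Multiset.count_eq_zero_of_notMem (Multiset.mem_toFinset.not.mp hj), pow_zero]

variable (b : AffineBasis (Fin 3) ℝ Plane) (c₁ c₂ : ℝ)

/-- The affine function with the corner values `1, c₁, c₂`. -/
noncomputable def dualForm : Plane →ᵃ[ℝ] ℝ := b.coord 0 + c₁ • b.coord 1 + c₂ • b.coord 2

theorem dualForm_apply (x : Plane) :
    dualForm b c₁ c₂ x = b.coords x 0 + c₁ * b.coords x 1 + c₂ * b.coords x 2 := rfl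

theorem eval_dualLinear (j : Fin 10) :
    eval (dualLinear (bary12 j)) [c₁, c₂] = 12 * dualForm b c₁ c₂ (vertex b j) := by
  simp only [dualForm_apply, coords_vertex, dualLinear, eval_cons, eval_nil, eval_int,
    List.tail_cons, List.headD_cons]
  ring

theorem eval_pairing (x : Plane) :
    eval pairing (c₁ :: c₂ :: vars b x) = dualForm b c₁ c₂ x := by
  rw [dualForm_apply, eq_sub_of_add_eq (eq_sub_of_add_eq (coords_sum b x))]
  simp only [pairing, vars, eval_cons, eval_nil, eval_int, List.tail_cons, List.headD_cons]
  push_cast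
  ring

theorem marsden {ρ : Plane → Fin 12} {x : Plane} (hx : x ∈ face b (ρ x)) (n : Fin 6) :
    ∑ s ∈ basis n, (s.dual.map fun j => dualForm b c₁ c₂ (vertex b j)).prod *
      ((s.weight : ℝ) * simplexSpline b ρ s.knots x) = dualForm b c₁ c₂ x ^ 5 := by
  have identity := eval_eq_of_eqv (eqv_marsdenSum n (ρ x)) (c₁ :: c₂ :: vars b x)
  have summand : ∀ s ∈ basis n,
      eval (tensor (scale (weight4 s) (dualPoly s.dual)) (piece 5 (encode s.knots) (ρ x)))
        (c₁ :: c₂ :: vars b x) = 4 * 12 ^ 5 *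
      ((s.dual.map fun j => dualForm b c₁ c₂ (vertex b j)).prod *
        ((s.weight : ℝ) * simplexSpline b ρ s.knots x)) := by
    intro s hs
    obtain ⟨hcard, hlt, hdual, -, hweight⟩ := knots_dual_weight_of_mem_basis hs
    have hweight' : (weight4 s : ℝ) = 4 * s.weight := by
      exact_mod_cast congrArg (Rat.cast (K := ℝ)) hweight
    simp only [eval_tensor, eval_scale, eval_dualPoly, eval_dualLinear b, Multiset.prod_map_mul,
      Multiset.map_const', Multiset.prod_replicate, hdual, hweight']
    rw [simplexSpline, hcard, simplexSplineAux_eq_eval_piece hx 5 hlt hcard]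
    ring
  have hnodup : (basisList n).Nodup := List.nodup_dedup _
  rw [marsdenSum, eval_sum, List.map_map, ← List.sum_toFinset _ hnodup,
    toFinset_basisList] at identity
  replace identity := (Finset.sum_congr rfl summand).symm.trans identity
  rw [← Finset.mul_sum, eval_scale, eval_pow, eval_pairing] at identity
  push_cast at identity
  linarith

end Marsden

/-! ### Polynomial functions -/

section PolynomialFunctions

/-- The space of polynomial functions of total degree at most `d` on the plane. -/
def polynomialFunctions (d : ℕ) : Submodule ℝ (Plane → ℝ) where
  carrier := {f | ∃ p : MvPolynomial (Fin 2) ℝ, p.totalDegree ≤ d ∧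
    ∀ x : Plane, f x = MvPolynomial.eval (fun i => x i) p}
  zero_mem' := ⟨0, by simp, fun x => by simp⟩
  add_mem' := by
    rintro f g ⟨p, hp, hf⟩ ⟨q, hq, hg⟩
    exact ⟨p + q, (MvPolynomial.totalDegree_add p q).trans (max_le hp hq), fun x => by
      simp [hf, hg]⟩
  smul_mem' := by
    rintro c f ⟨p, hp, hf⟩
    exact ⟨c • p, (MvPolynomial.totalDegree_smul_le c p).trans hp, fun x => by
      simp [hf, MvPolynomial.smul_eval]⟩

variable {d e : ℕ} {f g : Plane → ℝ}

theorem mem_polynomialFunctions_iff : f ∈ polynomialFunctions d ↔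
    ∃ p : MvPolynomial (Fin 2) ℝ, p.totalDegree ≤ d ∧
      ∀ x : Plane, f x = MvPolynomial.eval (fun i => x i) p := Iff.rfl

theorem polynomialFunctions_mono (h : d ≤ e) : polynomialFunctions d ≤ polynomialFunctions e :=
  fun _ ⟨p, hp, hf⟩ => ⟨p, hp.trans h, hf⟩

theorem const_mem_polynomialFunctions (c : ℝ) : (fun _ => c) ∈ polynomialFunctions d :=
  ⟨MvPolynomial.C c, by simp, fun x => by simp⟩

theorem mul_mem_polynomialFunctions (hf : f ∈ polynomialFunctions d)
    (hg : g ∈ polynomialFunctions e) : f * g ∈ polynomialFunctions (d + e) := by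
  obtain ⟨p, hp, hf⟩ := hf
  obtain ⟨q, hq, hg⟩ := hg
  exact ⟨p * q, (MvPolynomial.totalDegree_mul p q).trans (add_le_add hp hq), fun x => by
    simp [hf, hg]⟩

theorem pow_mem_polynomialFunctions (hf : f ∈ polynomialFunctions 1) (n : ℕ) :
    f ^ n ∈ polynomialFunctions n := by
  induction n with
  | zero => exact const_mem_polynomialFunctions 1
  | succ n ih => exact pow_succ f n ▸ mul_mem_polynomialFunctions ih hf

theorem coordinate_mem_polynomialFunctions (i : Fin 2) :
    (fun x : Plane => x i) ∈ polynomialFunctions 1 :=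
  ⟨MvPolynomial.X i, by simp, fun x => by simp⟩

theorem affineMap_mem_polynomialFunctions (a : Plane →ᵃ[ℝ] ℝ) : ⇑a ∈ polynomialFunctions 1 := by
  have expand : ⇑a = (∑ i, a.linear (EuclideanSpace.single i 1) • fun x : Plane => x i) +
      fun _ => a 0 := by
    funext x
    have hx : x = ∑ i, x i • EuclideanSpace.single i (1 : ℝ) :=
      ((EuclideanSpace.basisFun (Fin 2) ℝ).sum_repr x).symm.trans (by simp)
    conv_lhs => rw [AffineMap.decomp a, Pi.add_apply, hx, map_sum]
    simp [mul_comm]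
  rw [expand]
  exact add_mem (sum_mem fun i _ => Submodule.smul_mem _ _ (coordinate_mem_polynomialFunctions i))
    (const_mem_polynomialFunctions _)

end PolynomialFunctions

/-! ### Smoothness -/

section Smoothness

variable (b : AffineBasis (Fin 3) ℝ Plane)

theorem piece_mem_polynomialFunctions (d c : ℕ) (m : Fin 12) :
    (fun x => eval (piece d c m) (vars b x)) ∈ polynomialFunctions d := by
  have zero {d : ℕ} : (fun x => eval ([] : BivariatePoly) (vars b x)) ∈ polynomialFunctions d :=
    zero_mem _
  induction d generalizing c with
  | zero =>
    cases c with
    | zero => exact zero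
    | succ c =>
      rcases h : firstTriple (c + 1) with _ | ⟨i, j, k⟩ <;> simp only [piece, h]
      · exact zero
      · split_ifs
        · simp only [eval_const]
          exact const_mem_polynomialFunctions _
        · exact zero
  | succ d ih =>
    cases c with
    | zero => exact zero
    | succ c =>
      rcases h : firstTriple (c + 1) with _ | ⟨i, j, k⟩ <;> simp only [piece, h]
      · exact zero
      · simp only [eval_baryCombination]
        have term (f : Fin 3 → ℤ) (i : Fin 10) :
            (fun x => affineForm b f x * eval (piece d ((c + 1) / knotPrime i) m) (vars b x)) ∈
              polynomialFunctions (d + 1) :=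
          add_comm 1 d ▸ mul_mem_polynomialFunctions (affineMap_mem_polynomialFunctions _) (ih _)
        exact add_mem (add_mem (term _ _) (term _ _)) (term _ _)

theorem contDiff_affineMap {n : WithTop ℕ∞} (a : Plane →ᵃ[ℝ] ℝ) : ContDiff ℝ n a :=
  (⟨a, a.continuous_of_finiteDimensional⟩ : Plane →ᴬ[ℝ] ℝ).contDiff

theorem contDiff_eval_vars {n : WithTop ℕ∞} (p : BivariatePoly) :
    ContDiff ℝ n fun x => eval p (vars b x) := by
  have inner (r : List ℤ) : ContDiff ℝ n fun x => eval r (vars b x).tail := by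
    induction r with
    | nil => exact contDiff_const
    | cons z r ih => exact contDiff_const.add ((contDiff_affineMap (b.coord 2)).mul ih)
  induction p with
  | nil => exact contDiff_const
  | cons r p ih => exact (inner r).add ((contDiff_affineMap (b.coord 1)).mul ih)

theorem hasDerivAt_posPart_pow (n : ℕ) (x : ℝ) :
    HasDerivAt (fun y : ℝ => max y 0 ^ (n + 2)) ((n + 2) * max x 0 ^ (n + 1)) x := by
  have pow : HasDerivAt (fun y : ℝ => y ^ (n + 2)) ((n + 2) * x ^ (n + 1)) x := by
    simpa using hasDerivAt_pow (n + 2) x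
  have left {y : ℝ} (hy : y ≤ 0) : max y 0 ^ (n + 2) = 0 := by
    rw [max_eq_right hy, zero_pow (by omega)]
  have right {y : ℝ} (hy : 0 ≤ y) : max y 0 ^ (n + 2) = y ^ (n + 2) := by
    rw [max_eq_left hy]
  rcases lt_trichotomy x 0 with hx | rfl | hx
  · rw [max_eq_right hx.le, zero_pow (by omega), mul_zero]
    refine (hasDerivAt_const x (0 : ℝ)).congr_of_eventuallyEq ?_
    filter_upwards [Iio_mem_nhds hx] with y hy using left hy.le
  · rw [max_self, ← hasDerivWithinAt_univ, ← Set.Iic_union_Ici (a := (0 : ℝ))]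
    refine HasDerivWithinAt.union ?_ (pow.hasDerivWithinAt.congr (fun y hy => right hy)
      (right le_rfl))
    rw [zero_pow (by omega), mul_zero]
    exact (hasDerivWithinAt_const 0 _ (0 : ℝ)).congr (fun y hy => left hy) (left le_rfl)
  · rw [max_eq_left hx.le]
    refine pow.congr_of_eventuallyEq ?_
    filter_upwards [Ioi_mem_nhds hx] with y hy using right hy.le

theorem contDiff_posPart_pow (n : ℕ) : ContDiff ℝ n fun y : ℝ => max y 0 ^ (n + 1) := by
  induction n with
  | zero =>
    rw [Nat.cast_zero, contDiff_zero]
    fun_prop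
  | succ n ih =>
    have hderiv : deriv (fun y : ℝ => max y 0 ^ (n + 2)) =
        fun x : ℝ => ((n : ℝ) + 2) * max x 0 ^ (n + 1) :=
      funext fun x => (hasDerivAt_posPart_pow n x).deriv
    rw [Nat.cast_succ, contDiff_succ_iff_deriv, hderiv]
    exact ⟨fun x => (hasDerivAt_posPart_pow n x).differentiableAt, by simp,
      contDiff_const.mul ih⟩

/-- The function `p + ∑ qᵢ max(ℓᵢ, 0)⁴` with the pieces `P`. -/
noncomputable def truncatedSum (P : Fin 12 → BivariatePoly) (x : Plane) : ℝ :=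
  eval (P 9) (vars b x) + ∑ i, eval (jumpCofactor P i) (vars b x) *
    max (affineForm b (splitLine i).1 x) 0 ^ 4

theorem contDiff_truncatedSum (P : Fin 12 → BivariatePoly) : ContDiff ℝ 3 (truncatedSum b P) :=
  (contDiff_eval_vars b _).add (ContDiff.sum fun _ _ => (contDiff_eval_vars b _).mul
    ((contDiff_posPart_pow 3).comp (contDiff_affineMap _)))

theorem nonnegOnFace_neg_splitLine : ∀ i k, ¬ nonnegOnFace (splitLine i).1 k →
    nonnegOnFace (-(splitLine i).1) k := by
  decide +kernel

variable {b}

theorem max_affineForm_splitLine {k : Fin 12} {x : Plane} (hx : x ∈ face b k) (i : Fin 6) :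
    max (affineForm b (splitLine i).1 x) 0 =
      if nonnegOnFace (splitLine i).1 k then affineForm b (splitLine i).1 x else 0 := by
  split_ifs with h
  · exact max_eq_left ((nonnegOnFace_iff b _ k).mp h x hx)
  · have hneg := (nonnegOnFace_iff b _ k).mp (nonnegOnFace_neg_splitLine i k h) x hx
    refine max_eq_right ?_
    simp only [affineForm_apply, Pi.neg_apply] at hneg ⊢
    push_cast at hneg
    linarith

theorem eval_eq_truncatedSum {P : Fin 12 → BivariatePoly} (hP : isTruncated P) {k : Fin 12}
    {x : Plane} (hx : x ∈ face b k) : eval (P k) (vars b x) = truncatedSum b P x := by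
  rw [eval_eq_of_eqv (List.all_eq_true.mp hP k (List.mem_finRange k)), truncatedPiece, eval_add,
    truncatedSum, eval_sum, List.map_map, ← List.sum_toFinset _ ((List.nodup_finRange 6).filter _),
    List.toFinset_filter, List.toFinset_finRange, Finset.sum_filter]
  refine congrArg _ (Finset.sum_congr rfl fun i _ => ?_)
  rw [max_affineForm_splitLine hx i]
  split_ifs
  · simp only [Function.comp_apply, eval_mul, eval_pow, eval_affine]
  · rw [zero_pow four_ne_zero, mul_zero]

theorem vertex_mem_triangle (b : AffineBasis (Fin 3) ℝ Plane) (j : Fin 10) :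
    vertex b j ∈ triangle b := by
  have nonneg : ∀ j r, 0 ≤ bary12 j r := by decide
  rw [mem_triangle_iff, coords_vertex]
  exact fun r => div_nonneg (mod_cast nonneg j r) (by norm_num)

theorem face_subset_triangle (b : AffineBasis (Fin 3) ℝ Plane) (k : Fin 12) :
    face b k ⊆ triangle b :=
  convexHull_min (Set.range_subset_iff.mpr fun _ => vertex_mem_triangle b _) (convex_convexHull ℝ _)

variable {ρ : Plane → Fin 12} {n : Fin 6} {s : BasisElement}

theorem simplexSpline_eq_truncatedSum (hs : s ∈ basis n) {x : Plane} (hx : x ∈ face b (ρ x)) :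
    simplexSpline b ρ s.knots x = truncatedSum b (piece 5 (encode s.knots)) x := by
  obtain ⟨hcard, hlt, -⟩ := knots_dual_weight_of_mem_basis hs
  rw [simplexSpline, hcard, simplexSplineAux_eq_eval_piece hx 5 hlt hcard,
    eval_eq_truncatedSum (isTruncated_piece (encode_mem_knotCodes hs)) hx]

/-- The space `splineSpace v r d` as a subspace. -/
def splineSubmodule (v : Fin 3 → Plane) (r d : ℕ) : Submodule ℝ (Plane → ℝ) where
  carrier := splineSpace v r d
  zero_mem' := ⟨contDiffOn_const, fun _ => ⟨0, by simp, fun x _ => by simp⟩⟩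
  add_mem' := by
    rintro f g ⟨hf, pf⟩ ⟨hg, pg⟩
    refine ⟨hf.add hg, fun k => ?_⟩
    obtain ⟨p, hp, hfp⟩ := pf k
    obtain ⟨q, hq, hgq⟩ := pg k
    exact ⟨p + q, (MvPolynomial.totalDegree_add p q).trans (max_le hp hq), fun x hx => by
      simp [hfp x hx, hgq x hx]⟩
  smul_mem' := by
    rintro c f ⟨hf, pf⟩
    refine ⟨contDiffOn_const.smul hf, fun k => ?_⟩
    obtain ⟨p, hp, hfp⟩ := pf k
    exact ⟨c • p, (MvPolynomial.totalDegree_smul_le c p).trans hp, fun x hx => by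
      simp [hfp x hx, MvPolynomial.smul_eval]⟩

theorem simplexSpline_mem_splineSpace (hρ : IsFaceScheme b ρ) (hs : s ∈ basis n) :
    simplexSpline b ρ s.knots ∈ splineSpace b 3 5 := by
  have htrunc := isTruncated_piece (encode_mem_knotCodes hs)
  have heq : Set.EqOn (simplexSpline b ρ s.knots) (truncatedSum b (piece 5 (encode s.knots)))
      (triangle b) := fun x hx => simplexSpline_eq_truncatedSum hs (hρ x hx)
  refine ⟨(contDiff_truncatedSum b _).contDiffOn.congr heq, fun k => ?_⟩
  obtain ⟨p, hp, hpiece⟩ := piece_mem_polynomialFunctions b 5 (encode s.knots) k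
  refine ⟨p, hp, fun x hx => ?_⟩
  rw [heq (face_subset_triangle b k hx), ← eval_eq_truncatedSum htrunc hx, ← hpiece]

theorem quasiInterpolant_mem_splineSpace (hρ : IsFaceScheme b ρ) (n : Fin 6) (f : Plane → ℝ) :
    quasiInterpolant b ρ n f ∈ splineSpace b 3 5 := by
  have heq : quasiInterpolant b ρ n f = ∑ s ∈ basis n,
      (coeffFunctional (s.dual.map (vertex b)) f * s.weight) • simplexSpline b ρ s.knots := by
    funext x
    simp [quasiInterpolant, mul_assoc]
  rw [heq]
  exact (splineSubmodule b 3 5).sum_mem fun s hs =>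
    (splineSubmodule b 3 5).smul_mem _ (simplexSpline_mem_splineSpace hρ hs)

end Smoothness

/-! ### The dual functionals -/

section DualFunctionals

variable {E : Type*} [AddCommGroup E] [Module ℝ E]

theorem affineMap_average (a : E →ᵃ[ℝ] ℝ) {R : Multiset E} (hR : R.card ≠ 0) :
    a ((R.card : ℝ)⁻¹ • R.sum) = (R.card : ℝ)⁻¹ * (R.map a).sum := by
  have hcard : (R.card : ℝ) ≠ 0 := by exact_mod_cast hR
  have hsum : (R.map a).sum = a.linear R.sum + R.card * a 0 := by
    rw [AffineMap.decomp a, map_multiset_sum]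
    simp [Multiset.sum_map_add]
  rw [hsum, mul_add, inv_mul_cancel_left₀ hcard, AffineMap.decomp a]
  simp

theorem average_mem {s : Set E} (hs : Convex ℝ s) {R : Multiset E} (hR : R.card ≠ 0)
    (hmem : ∀ p ∈ R, p ∈ s) : (R.card : ℝ)⁻¹ • R.sum ∈ s := by
  classical
  have hcard : (R.card : ℝ) ≠ 0 := by exact_mod_cast hR
  rw [Finset.sum_multiset_count, Finset.smul_sum]
  simp_rw [← Nat.cast_smul_eq_nsmul ℝ, smul_smul]
  refine hs.sum_mem (fun _ _ => by positivity) ?_ fun p hp => hmem p (Multiset.mem_toFinset.mp hp)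
  rw [← Finset.mul_sum, ← Nat.cast_sum, Multiset.toFinset_sum_count_eq, inv_mul_cancel₀ hcard]

theorem sum_powersetCard_pow_five_eq_prod {T : Multiset ℝ} (hT : T.card = 5) :
    ∑ k ∈ Finset.Icc (1 : ℕ) 5, ((k : ℝ) ^ 5 / (Nat.factorial 5 : ℝ)) * (-1) ^ (k - 1) *
      ((T.powersetCard k).map fun R => ((k : ℝ)⁻¹ * R.sum) ^ 5).sum = T.prod := by
  obtain ⟨a, b, c, d, e, rfl⟩ : ∃ a b c d e, T = a ::ₘ b ::ₘ c ::ₘ d ::ₘ e ::ₘ 0 := by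
    induction T using Quot.inductionOn with
    | h l => match l, hT with | [a, b, c, d, e], _ => exact ⟨a, b, c, d, e, rfl⟩
  rw [show Finset.Icc (1 : ℕ) 5 = {1, 2, 3, 4, 5} by decide]
  simp [Multiset.powersetCard_cons, Multiset.powersetCard_one, Nat.factorial]
  ring

variable {P : Multiset Plane}

theorem coeffFunctional_add (f g : Plane → ℝ) :
    coeffFunctional P (f + g) = coeffFunctional P f + coeffFunctional P g := by
  simp only [coeffFunctional, Pi.add_apply, Multiset.sum_map_add, mul_add, Finset.sum_add_distrib]

theorem coeffFunctional_smul (c : ℝ) (f : Plane → ℝ) :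
    coeffFunctional P (c • f) = c * coeffFunctional P f := by
  simp only [coeffFunctional, Pi.smul_apply, smul_eq_mul, Multiset.sum_map_mul_left,
    Finset.mul_sum, mul_left_comm]

theorem coeffFunctional_affineMap_pow (a : Plane →ᵃ[ℝ] ℝ) (hP : P.card = 5) :
    coeffFunctional P (a ^ 5) = (P.map a).prod := by
  rw [← sum_powersetCard_pow_five_eq_prod (by simpa using hP), coeffFunctional]
  refine Finset.sum_congr rfl fun k hk => ?_
  rw [Multiset.powersetCard_map, Multiset.map_map]
  congr 2
  refine Multiset.map_congr rfl fun R hR => ?_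
  obtain rfl := (Multiset.mem_powersetCard.mp hR).2
  have hcard : R.card ≠ 0 := Nat.one_le_iff_ne_zero.mp (Finset.mem_Icc.mp hk).1
  rw [Pi.pow_apply, affineMap_average a hcard, Function.comp_apply]

theorem abs_coeffFunctional_le {s : Set Plane} (hs : Convex ℝ s) (hcard : P.card = 5)
    (hP : ∀ p ∈ P, p ∈ s) {f : Plane → ℝ} {M : ℝ} (hf : ∀ y ∈ s, |f y| ≤ M) :
    |coeffFunctional P f| ≤ 275 / 3 * M := by
  have hinner (k : ℕ) (hk : k ∈ Finset.Icc 1 5) :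
      |((P.powersetCard k).map fun R => f ((k : ℝ)⁻¹ • R.sum)).sum| ≤ (Nat.choose 5 k : ℝ) * M := by
    refine Multiset.abs_sum_le_sum_abs.trans ?_
    rw [Multiset.map_map, ← hcard, ← Multiset.card_powersetCard, ← nsmul_eq_mul]
    refine (Multiset.sum_le_card_nsmul _ M ?_).trans_eq (by rw [Multiset.card_map])
    rintro _ hy
    obtain ⟨R, hR, rfl⟩ := Multiset.mem_map.mp hy
    obtain ⟨hle, rfl⟩ := Multiset.mem_powersetCard.mp hR
    exact hf _ (average_mem hs (Nat.one_le_iff_ne_zero.mp (Finset.mem_Icc.mp hk).1)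
      fun p hp => hP p (Multiset.mem_of_le hle hp))
  calc |coeffFunctional P f|
      ≤ ∑ k ∈ Finset.Icc (1 : ℕ) 5, (k : ℝ) ^ 5 / Nat.factorial 5 * (Nat.choose 5 k * M) := by
        refine (Finset.abs_sum_le_sum_abs _ _).trans (Finset.sum_le_sum fun k hk => ?_)
        rw [abs_mul, abs_mul, abs_pow, abs_neg, abs_one, one_pow, mul_one,
          abs_of_nonneg (by positivity)]
        exact mul_le_mul_of_nonneg_left (hinner k hk) (by positivity)
    _ = 275 / 3 * M := by
        rw [show Finset.Icc (1 : ℕ) 5 = {1, 2, 3, 4, 5} by decide]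
        simp only [Nat.factorial, Nat.choose, Finset.mem_insert, Finset.mem_singleton,
          Finset.sum_insert, Finset.sum_singleton, not_false_eq_true,
          Nat.reduceEqDiff, or_self]
        norm_num
        ring

end DualFunctionals

/-! ### Linear functionals on polynomial functions -/

section PowersOfAffineFunctions

theorem coeff_eq_zero_of_forall_sum_mul_pow {R : Type*} [CommRing R] [IsDomain R] [Infinite R]
    {n : ℕ} {A : ℕ → R} (h : ∀ t : R, ∑ i ∈ Finset.range n, A i * t ^ i = 0) {i : ℕ} (hi : i < n) :
    A i = 0 := by
  have hp : ∑ i ∈ Finset.range n, Polynomial.monomial i (A i) = 0 :=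
    Polynomial.funext fun t => by
      simpa [Polynomial.eval_finsetSum, Polynomial.eval_monomial] using h t
  simpa [Polynomial.finsetSum_coeff, Polynomial.coeff_monomial, hi] using
    congrArg (fun p => Polynomial.coeff p i) hp

theorem add_add_one_pow {R : Type*} [CommSemiring R] (x y : R) (d : ℕ) :
    (x + (y + 1)) ^ d = ∑ i ∈ Finset.range (d + 1), ∑ j ∈ Finset.range (d - i + 1),
      (((d - i).choose j * d.choose i : ℕ) : R) * (x ^ i * y ^ j) := by
  rw [add_pow]
  refine Finset.sum_congr rfl fun i _ => ?_
  rw [add_pow, Finset.mul_sum, Finset.sum_mul]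
  refine Finset.sum_congr rfl fun j _ => ?_
  push_cast
  ring

theorem map_mul_pow_eq_zero {𝕜 A : Type*} [Field 𝕜] [CharZero 𝕜] [CommRing A] [Algebra 𝕜 A]
    {L : A →ₗ[𝕜] 𝕜} {u w : A} {d : ℕ} (h : ∀ s t : 𝕜, L ((s • u + (t • w + 1)) ^ d) = 0)
    {i j : ℕ} (hij : i + j ≤ d) : L (u ^ i * w ^ j) = 0 := by
  have expand (s t : 𝕜) : ∑ i ∈ Finset.range (d + 1), (∑ j ∈ Finset.range (d - i + 1),
      ((d - i).choose j * d.choose i : ℕ) * L (u ^ i * w ^ j) * t ^ j) * s ^ i = 0 := by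
    rw [← h s t, add_add_one_pow, map_sum]
    refine Finset.sum_congr rfl fun i _ => ?_
    rw [map_sum, Finset.sum_mul]
    refine Finset.sum_congr rfl fun j _ => ?_
    rw [smul_pow, smul_pow, smul_mul_smul_comm, ← map_natCast (algebraMap 𝕜 A),
      ← Algebra.smul_def, map_smul, map_smul, smul_eq_mul, smul_eq_mul]
    ring
  have hcoeff := coeff_eq_zero_of_forall_sum_mul_pow (fun t =>
    coeff_eq_zero_of_forall_sum_mul_pow (fun s => expand s t) (show i < d + 1 by omega))
    (show j < d - i + 1 by omega)
  refine (mul_eq_zero.mp hcoeff).resolve_left (Nat.cast_ne_zero.mpr ?_)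
  exact (Nat.mul_pos (Nat.choose_pos (by omega)) (Nat.choose_pos (by omega))).ne'

/-- The coordinate function `x ↦ x i`. -/
noncomputable def coordinate (i : Fin 2) : Plane →ᵃ[ℝ] ℝ :=
  (EuclideanSpace.proj i).toLinearMap.toAffineMap

theorem polynomialFunctions_le_ker_of_affineMap_pow {L : (Plane → ℝ) →ₗ[ℝ] ℝ} {d : ℕ}
    (h : ∀ a : Plane →ᵃ[ℝ] ℝ, L (a ^ d) = 0) : polynomialFunctions d ≤ LinearMap.ker L := by
  rintro f ⟨p, hp, hfp⟩
  have expand : f = ∑ m ∈ p.support, p.coeff m •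
      ((coordinate 0 : Plane → ℝ) ^ m 0 * (coordinate 1 : Plane → ℝ) ^ m 1) := by
    funext y
    rw [hfp, MvPolynomial.eval_eq']
    simp [coordinate]
  rw [LinearMap.mem_ker, expand, map_sum]
  refine Finset.sum_eq_zero fun m hm => ?_
  have hdeg : m 0 + m 1 ≤ d := by
    have := MvPolynomial.le_totalDegree hm
    rw [Finsupp.sum_fintype _ _ (fun _ => rfl), Fin.sum_univ_two] at this
    exact this.trans hp
  rw [map_smul, map_mul_pow_eq_zero (fun s t => ?_) hdeg, smul_zero]
  exact h (s • coordinate 0 + (t • coordinate 1 + AffineMap.const ℝ Plane 1))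

end PowersOfAffineFunctions

/-! ### The quasi-interpolant as a linear functional -/

section QuasiInterpolant

variable {b : AffineBasis (Fin 3) ℝ Plane} {ρ : Plane → Fin 12} {n : Fin 6} {x : Plane}

theorem eq_smul_dualForm {a : Plane →ᵃ[ℝ] ℝ} (h : a (b 0) ≠ 0) :
    a = a (b 0) • dualForm b (a (b 1) / a (b 0)) (a (b 2) / a (b 0)) := by
  ext x
  conv_lhs => rw [← b.affineCombination_coord_eq_self x, Finset.map_affineCombination _ _ _
    (b.sum_coord_apply_eq_one x), Finset.affineCombination_eq_linear_combination _ _ _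
    (b.sum_coord_apply_eq_one x), Fin.sum_univ_three]
  rw [AffineMap.coe_smul, Pi.smul_apply, dualForm_apply]
  simp only [AffineBasis.coords_apply, Function.comp_apply, smul_eq_mul]
  field_simp

theorem marsden_affineMap (hx : x ∈ face b (ρ x)) (n : Fin 6) (a : Plane →ᵃ[ℝ] ℝ) :
    ∑ s ∈ basis n, (s.dual.map fun j => a (vertex b j)).prod *
      ((s.weight : ℝ) * simplexSpline b ρ s.knots x) = a x ^ 5 := by
  have hne {a : Plane →ᵃ[ℝ] ℝ} (ha : a (b 0) ≠ 0) :
      ∑ s ∈ basis n, (s.dual.map fun j => a (vertex b j)).prod *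
        ((s.weight : ℝ) * simplexSpline b ρ s.knots x) = a x ^ 5 := by
    rw [eq_smul_dualForm ha, AffineMap.coe_smul, Pi.smul_apply, smul_eq_mul, mul_pow,
      ← marsden b _ _ hx n, Finset.mul_sum]
    refine Finset.sum_congr rfl fun s hs => ?_
    obtain ⟨-, -, hdual, -⟩ := knots_dual_weight_of_mem_basis hs
    simp only [Pi.smul_apply, smul_eq_mul, Multiset.prod_map_mul, Multiset.map_const',
      Multiset.prod_replicate, hdual, mul_assoc]
  -- Both sides are continuous in `t` after adding the constant `t` to `a`.
  have hext : (fun t : ℝ => ∑ s ∈ basis n, (s.dual.map fun j => a (vertex b j) + t).prod *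
      ((s.weight : ℝ) * simplexSpline b ρ s.knots x)) = fun t => (a x + t) ^ 5 := by
    refine Continuous.ext_on (dense_compl_singleton (-a (b 0))) ?_ (by fun_prop) fun t ht => ?_
    · exact continuous_finsetSum _ fun s _ => (continuous_multiset_prod s.dual fun j _ =>
        by fun_prop).mul continuous_const
    · exact hne (a := a + AffineMap.const ℝ Plane t) fun h => ht (eq_neg_of_add_eq_zero_right h)
  simpa using congrFun hext 0

theorem sum_weight_mul_simplexSpline (hx : x ∈ face b (ρ x)) (n : Fin 6) :
    ∑ s ∈ basis n, (s.weight : ℝ) * simplexSpline b ρ s.knots x = 1 := by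
  simpa using marsden_affineMap hx n (AffineMap.const ℝ Plane 1)

variable (b ρ n x) in
/-- The value of the quasi-interpolant at `x`, as a linear functional. -/
noncomputable def quasiInterpolantAt : (Plane → ℝ) →ₗ[ℝ] ℝ where
  toFun f := quasiInterpolant b ρ n f x
  map_add' f g := by
    simp only [quasiInterpolant, coeffFunctional_add, add_mul, Finset.sum_add_distrib]
  map_smul' c f := by
    simp only [quasiInterpolant, coeffFunctional_smul, mul_assoc, Finset.mul_sum, smul_eq_mul,
      RingHom.id_apply]

theorem quasiInterpolant_of_mem_polynomialFunctions (hx : x ∈ face b (ρ x)) (n : Fin 6)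
    {f : Plane → ℝ} (hf : f ∈ polynomialFunctions 5) : quasiInterpolant b ρ n f x = f x := by
  have hker : f ∈ LinearMap.ker (quasiInterpolantAt b ρ n x - LinearMap.proj x) :=
    polynomialFunctions_le_ker_of_affineMap_pow (fun a => sub_eq_zero.mpr ?_) hf
  · exact sub_eq_zero.mp hker
  rw [LinearMap.proj_apply, Pi.pow_apply, ← marsden_affineMap hx n a]
  refine Finset.sum_congr rfl fun s hs => ?_
  obtain ⟨-, -, hdual, -⟩ := knots_dual_weight_of_mem_basis hs
  rw [coeffFunctional_affineMap_pow a (by simpa using hdual), Multiset.map_map]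
  rfl

theorem abs_quasiInterpolant_le (hx : x ∈ face b (ρ x)) (n : Fin 6) {f : Plane → ℝ} {M : ℝ}
    (hf : ∀ y ∈ triangle b, |f y| ≤ M) : |quasiInterpolant b ρ n f x| ≤ 275 / 3 * M := by
  calc |quasiInterpolant b ρ n f x|
      ≤ ∑ s ∈ basis n, 275 / 3 * M * ((s.weight : ℝ) * simplexSpline b ρ s.knots x) := by
        refine (Finset.abs_sum_le_sum_abs _ _).trans (Finset.sum_le_sum fun s hs => ?_)
        obtain ⟨-, -, hdual, hweight, -⟩ := knots_dual_weight_of_mem_basis hs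
        have hspline : 0 ≤ (s.weight : ℝ) * simplexSpline b ρ s.knots x :=
          mul_nonneg (by exact_mod_cast hweight) (simplexSpline_nonneg hs hx)
        rw [abs_mul, abs_of_nonneg hspline]
        refine mul_le_mul_of_nonneg_right (abs_coeffFunctional_le (convex_convexHull ℝ _)
          (by simpa using hdual) (fun p hp => ?_) hf) hspline
        obtain ⟨j, -, rfl⟩ := Multiset.mem_map.mp hp
        exact vertex_mem_triangle b j
    _ = 275 / 3 * M := by
        rw [← Finset.mul_sum, sum_weight_mul_simplexSpline hx, mul_one]

/-- The norm of the error operator `f ↦ Q f - f` is at most `275 / 3 + 1 = 278 / 3`, and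
subtracting a quintic polynomial from `f` does not change the error. -/
theorem abs_quasiInterpolant_sub_le (hx : x ∈ face b (ρ x)) (n : Fin 6)
    {f p : Plane → ℝ} {M : ℝ} (hp : p ∈ polynomialFunctions 5)
    (hf : ∀ y ∈ triangle b, |f y - p y| ≤ M) :
    |quasiInterpolant b ρ n f x - f x| ≤ 278 / 3 * M := by
  have herror : quasiInterpolant b ρ n f x - f x =
      quasiInterpolant b ρ n (f - p) x - (f x - p x) := by
    have := map_sub (quasiInterpolantAt b ρ n x) f p
    change quasiInterpolant b ρ n (f - p) x = quasiInterpolant b ρ n f x -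
      quasiInterpolant b ρ n p x at this
    rw [this, quasiInterpolant_of_mem_polynomialFunctions hx n hp]
    ring
  rw [herror]
  have := abs_quasiInterpolant_le hx n (f := f - p) hf
  linarith [abs_sub (quasiInterpolant b ρ n (f - p) x) (f x - p x),
    hf x (face_subset_triangle b _ hx)]

end QuasiInterpolant

section SupNorm

variable {A : Set Plane} {f : Plane → ℝ}

theorem abs_le_supNorm (hf : BddAbove ((fun x => |f x|) '' A)) {x : Plane} (hx : x ∈ A) :
    |f x| ≤ supNorm A f :=
  le_csSup hf ⟨x, hx, rfl⟩

theorem supNorm_le {M : ℝ} (hM : 0 ≤ M) (h : ∀ x ∈ A, |f x| ≤ M) : supNorm A f ≤ M :=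
  Real.sSup_le (Set.forall_mem_image.mpr h) hM

theorem supNorm_nonneg : 0 ≤ supNorm A f :=
  Real.sSup_nonneg (Set.forall_mem_image.mpr fun _ _ => abs_nonneg _)

end SupNorm

/-! ### Taylor polynomials -/

section Taylor

/-- The mixed partial derivative of multi-index `α`. -/
noncomputable def mixedDeriv (α : ℕ × ℕ) (f : Plane → ℝ) : Plane → ℝ :=
  (partialDeriv 0)^[α.1] ((partialDeriv 1)^[α.2] f)

/-- The space of smooth functions on the plane. -/
def smoothFunctions : Submodule ℝ (Plane → ℝ) where
  carrier := {f | ContDiff ℝ ∞ f}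
  add_mem' hf hg := by
    rw [Set.mem_ofPred_eq] at *
    exact hf.add hg
  zero_mem' := show ContDiff ℝ ∞ fun _ : Plane => (0 : ℝ) from contDiff_const
  smul_mem' c f hf := by
    rw [Set.mem_ofPred_eq] at *
    exact contDiff_const.smul hf

variable {f : Plane → ℝ}

theorem contDiff_coe (f : smoothFunctions) : ContDiff ℝ ∞ (f : Plane → ℝ) :=
  f.2

theorem contDiff_partialDeriv (hf : ContDiff ℝ ∞ f) (i : Fin 2) :
    ContDiff ℝ ∞ (partialDeriv i f) :=
  (hf.fderiv_right (m := ∞) (by simp)).clm_apply contDiff_const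

theorem contDiff_partialDeriv_iterate (hf : ContDiff ℝ ∞ f) (i : Fin 2) (n : ℕ) :
    ContDiff ℝ ∞ ((partialDeriv i)^[n] f) := by
  induction n with
  | zero => exact hf
  | succ n ih =>
    rw [Function.iterate_succ_apply']
    exact contDiff_partialDeriv ih i

theorem partialDeriv_partialDeriv (hf : ContDiff ℝ ∞ f) (i j : Fin 2) (x : Plane) :
    partialDeriv i (partialDeriv j f) x =
      fderiv ℝ (fderiv ℝ f) x (EuclideanSpace.single i 1) (EuclideanSpace.single j 1) := by
  have hd : DifferentiableAt ℝ (fderiv ℝ f) x :=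
    (hf.fderiv_right (m := ∞) (by simp)).differentiable (by simp) x
  unfold partialDeriv
  rw [fderiv_clm_apply hd (differentiableAt_const _)]
  simp

theorem fderiv_apply_eq_partialDeriv (f : Plane → ℝ) (x w : Plane) :
    fderiv ℝ f x w = w 0 * partialDeriv 0 f x + w 1 * partialDeriv 1 f x := by
  have hw : w = ∑ i, w i • EuclideanSpace.single i (1 : ℝ) :=
    ((EuclideanSpace.basisFun (Fin 2) ℝ).sum_repr w).symm.trans (by simp)
  conv_lhs => rw [hw, Fin.sum_univ_two]
  simp [partialDeriv]

/-- The partial derivative as an endomorphism of the space of smooth functions. -/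
noncomputable def partialEnd (i : Fin 2) : Module.End ℝ smoothFunctions where
  toFun f := ⟨partialDeriv i f, contDiff_partialDeriv (contDiff_coe f) i⟩
  map_add' f g := by
    ext x
    simp [partialDeriv, fderiv_add ((contDiff_coe f).differentiable (by simp) x)
      ((contDiff_coe g).differentiable (by simp) x)]
  map_smul' c f := by
    ext x
    simp [partialDeriv, fderiv_const_smul ((contDiff_coe f).differentiable (by simp) x) c]

theorem commute_partialEnd : Commute (partialEnd 0) (partialEnd 1) := by
  refine LinearMap.ext fun f => Subtype.ext (funext fun x => ?_)
  change partialDeriv 0 (partialDeriv 1 f) x = partialDeriv 1 (partialDeriv 0 f) x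
  have hf := contDiff_coe f
  rw [partialDeriv_partialDeriv hf, partialDeriv_partialDeriv hf]
  exact (contDiff_infty.mp hf 2).contDiffAt.isSymmSndFDerivAt (by simp) _ _

theorem coe_partialEnd_pow (i : Fin 2) (n : ℕ) (f : smoothFunctions) :
    ((partialEnd i ^ n) f : Plane → ℝ) = (partialDeriv i)^[n] f := by
  induction n with
  | zero => rfl
  | succ n ih =>
    rw [pow_succ', Function.iterate_succ_apply', ← ih]
    rfl

/-- The `n`-th derivative of `f` at `x` in the direction `w`, for smooth `f`, expanded into mixed
partial derivatives. -/
noncomputable def directionalDeriv (n : ℕ) (f : Plane → ℝ) (x w : Plane) : ℝ :=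
  ∑ α ∈ Finset.HasAntidiagonal.antidiagonal n,
    n.choose α.1 * (w 0 ^ α.1 * w 1 ^ α.2) * mixedDeriv α f x

theorem smul_partialEnd_add_pow_apply (f : smoothFunctions) (w x : Plane) (n : ℕ) :
    (((w 0 • partialEnd 0 + w 1 • partialEnd 1) ^ n) f : Plane → ℝ) x =
      directionalDeriv n f x w := by
  have hc : Commute (w 0 • partialEnd 0) (w 1 • partialEnd 1) :=
    (commute_partialEnd.smul_left _).smul_right _
  rw [hc.add_pow', LinearMap.sum_apply, Submodule.coe_sum, Finset.sum_apply]
  refine Finset.sum_congr rfl fun α _ => ?_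
  rw [smul_pow, smul_pow, smul_mul_smul_comm, LinearMap.smul_apply, LinearMap.smul_apply,
    Module.End.mul_apply, Submodule.coe_smul_of_tower, Submodule.coe_smul, Pi.smul_apply,
    Pi.smul_apply, coe_partialEnd_pow, coe_partialEnd_pow, nsmul_eq_mul, smul_eq_mul, ← mul_assoc]
  rfl

theorem iteratedDeriv_line (hf : ContDiff ℝ ∞ f) (z w : Plane) (n : ℕ) :
    iteratedDeriv n (fun s : ℝ => f (z + s • w)) =
      fun s => directionalDeriv n f (z + s • w) w := by
  suffices h : iteratedDeriv n (fun s : ℝ => f (z + s • w)) = fun s =>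
      (((w 0 • partialEnd 0 + w 1 • partialEnd 1) ^ n) ⟨f, hf⟩ : Plane → ℝ) (z + s • w) by
    simpa only [smul_partialEnd_add_pow_apply] using h
  induction n with
  | zero => simp
  | succ n ih =>
    rw [iteratedDeriv_succ, ih]
    funext s
    set g := ((w 0 • partialEnd 0 + w 1 • partialEnd 1) ^ n) ⟨f, hf⟩
    have hline : HasDerivAt (fun s : ℝ => z + s • w) w s := by
      simpa using ((hasDerivAt_id s).smul_const w).const_add z
    have hg := ((contDiff_coe g).differentiable (by simp)
      (z + s • w)).hasFDerivAt.comp_hasDerivAt s hline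
    refine hg.deriv.trans ?_
    rw [fderiv_apply_eq_partialDeriv, pow_succ']
    rfl

theorem abs_directionalDeriv_le {n : ℕ} {x : Plane} (w : Plane) {M : ℝ}
    (hM : ∀ α : ℕ × ℕ, α.1 + α.2 = n → |mixedDeriv α f x| ≤ M) :
    |directionalDeriv n f x w| ≤ (2 * ‖w‖) ^ n * M := by
  have hcoord (i : Fin 2) : |w i| ≤ ‖w‖ := by simpa using PiLp.norm_apply_le w i
  calc |directionalDeriv n f x w|
      ≤ ∑ α ∈ Finset.HasAntidiagonal.antidiagonal n,
          n.choose α.1 * (‖w‖ ^ α.1 * ‖w‖ ^ α.2) * M := by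
        refine (Finset.abs_sum_le_sum_abs _ _).trans (Finset.sum_le_sum fun α hα => ?_)
        rw [abs_mul, abs_mul, abs_mul, abs_pow, abs_pow, Nat.abs_cast]
        gcongr
        exacts [hcoord 0, hcoord 1, hM α (Finset.HasAntidiagonal.mem_antidiagonal.mp hα)]
    _ = (2 * ‖w‖) ^ n * M := by
        simp only [two_mul, (Commute.all ‖w‖ ‖w‖).add_pow', nsmul_eq_mul, Finset.sum_mul]

/-- The Taylor polynomial of degree `d` of `f` at `z`, as a function of the increment `w`. -/
noncomputable def taylorPolynomial (d : ℕ) (f : Plane → ℝ) (z w : Plane) : ℝ :=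
  ∑ k ∈ Finset.range (d + 1), (k.factorial : ℝ)⁻¹ * directionalDeriv k f z w

theorem taylorPolynomial_comp_mem_polynomialFunctions (d : ℕ) (f : Plane → ℝ) (z : Plane)
    (u : Plane →ᵃ[ℝ] Plane) :
    (fun y => taylorPolynomial d f z (u y)) ∈ polynomialFunctions d := by
  have hu (i : Fin 2) : (fun y => u y i) ∈ polynomialFunctions 1 :=
    affineMap_mem_polynomialFunctions ((coordinate i).comp u)
  have expand : (fun y => taylorPolynomial d f z (u y)) = ∑ k ∈ Finset.range (d + 1),
      (k.factorial : ℝ)⁻¹ • ∑ α ∈ Finset.HasAntidiagonal.antidiagonal k,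
        (k.choose α.1 * mixedDeriv α f z) • ((fun y => u y 0) ^ α.1 * (fun y => u y 1) ^ α.2) := by
    funext y
    simp [taylorPolynomial, directionalDeriv, mul_right_comm]
  rw [expand]
  refine sum_mem fun k hk => Submodule.smul_mem _ _ (sum_mem fun α hα => Submodule.smul_mem _ _ ?_)
  refine polynomialFunctions_mono ?_ (mul_mem_polynomialFunctions
    (pow_mem_polynomialFunctions (hu 0) _) (pow_mem_polynomialFunctions (hu 1) _))
  rw [Finset.HasAntidiagonal.mem_antidiagonal.mp hα]
  exact Nat.lt_succ_iff.mp (Finset.mem_range.mp hk)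

theorem abs_sub_taylorPolynomial_le (hf : ContDiff ℝ ∞ f) (d : ℕ) {z w : Plane} {M : ℝ}
    (hM : ∀ s ∈ Set.Icc (0 : ℝ) 1, ∀ α : ℕ × ℕ, α.1 + α.2 = d + 1 →
      |mixedDeriv α f (z + s • w)| ≤ M) :
    |f (z + w) - taylorPolynomial d f z w| ≤ (2 * ‖w‖) ^ (d + 1) * M / d.factorial := by
  have hline : ContDiff ℝ ∞ fun s : ℝ => f (z + s • w) :=
    hf.comp (contDiff_const.add (contDiff_id.smul contDiff_const))
  have hiter (n : ℕ) {s : ℝ} (hs : s ∈ Set.Icc (0 : ℝ) 1) :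
      iteratedDerivWithin n (fun s : ℝ => f (z + s • w)) (Set.Icc 0 1) s =
        directionalDeriv n f (z + s • w) w := by
    rw [iteratedDerivWithin_eq_iteratedDeriv (uniqueDiffOn_Icc one_pos)
      (contDiff_infty.mp hline _).contDiffAt hs, iteratedDeriv_line hf]
  have hremainder := taylor_mean_remainder_bound (x := 1) (n := d) zero_le_one
    (contDiff_infty.mp hline _).contDiffOn (by simp) fun s hs =>
      (congrArg norm (hiter _ hs)).trans_le (abs_directionalDeriv_le w (hM s hs))
  have htaylor : taylorWithinEval (fun s : ℝ => f (z + s • w)) d (Set.Icc 0 1) 0 1 =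
      taylorPolynomial d f z w := by
    rw [taylor_within_apply]
    refine Finset.sum_congr rfl fun k _ => ?_
    rw [hiter k (by simp)]
    simp
  rwa [htaylor, one_smul, sub_zero, one_pow, mul_one, Real.norm_eq_abs] at hremainder

end Taylor

/-! ### Mollification -/

section Mollification

open ContinuousLinearMap
open scoped Convolution

variable {f g η : Plane → ℝ}

theorem partialDeriv_convolution (hf : LocallyIntegrable f) (hη : ContDiff ℝ ∞ η)
    (hηc : HasCompactSupport η) (i : Fin 2) :
    partialDeriv i (f ⋆[lsmul ℝ ℝ] η) = f ⋆[lsmul ℝ ℝ] partialDeriv i η := by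
  funext x
  have hη₁ : ContDiff ℝ 1 η := contDiff_infty.mp hη 1
  unfold partialDeriv
  rw [(hηc.hasFDerivAt_convolution_right (lsmul ℝ ℝ) hf hη₁ x).fderiv,
    convolution_precompR_apply (lsmul ℝ ℝ) hf (hηc.fderiv ℝ) (hη₁.continuous_fderiv one_ne_zero)]

theorem hasCompactSupport_partialDeriv_iterate (hηc : HasCompactSupport η) (i : Fin 2) (n : ℕ) :
    HasCompactSupport ((partialDeriv i)^[n] η) := by
  induction n with
  | zero => exact hηc
  | succ n ih =>
    rw [Function.iterate_succ_apply']
    exact ih.fderiv_apply ℝ _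

theorem partialDeriv_iterate_convolution (hf : LocallyIntegrable f) (hη : ContDiff ℝ ∞ η)
    (hηc : HasCompactSupport η) (i : Fin 2) (n : ℕ) :
    (partialDeriv i)^[n] (f ⋆[lsmul ℝ ℝ] η) = f ⋆[lsmul ℝ ℝ] (partialDeriv i)^[n] η := by
  induction n with
  | zero => rfl
  | succ n ih =>
    rw [Function.iterate_succ_apply', Function.iterate_succ_apply', ih,
      partialDeriv_convolution hf (contDiff_partialDeriv_iterate hη i n)
        (hasCompactSupport_partialDeriv_iterate hηc i n)]

theorem mixedDeriv_convolution (hf : LocallyIntegrable f) (hη : ContDiff ℝ ∞ η)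
    (hηc : HasCompactSupport η) (α : ℕ × ℕ) :
    mixedDeriv α (f ⋆[lsmul ℝ ℝ] η) = f ⋆[lsmul ℝ ℝ] mixedDeriv α η := by
  unfold mixedDeriv
  rw [partialDeriv_iterate_convolution hf hη hηc, partialDeriv_iterate_convolution hf
    (contDiff_partialDeriv_iterate hη 1 α.2) (hasCompactSupport_partialDeriv_iterate hηc 1 α.2)]

theorem partialDeriv_const_mul_comp_sub_left (hη : Differentiable ℝ η) (x : Plane) (c : ℝ)
    (i : Fin 2) :
    partialDeriv i (fun y => c * η (x - y)) = fun y => -c * partialDeriv i η (x - y) := by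
  funext y
  have hsub : HasFDerivAt (fun y : Plane => x - y) (-(ContinuousLinearMap.id ℝ Plane)) y :=
    (hasFDerivAt_id y).const_sub x
  have hderiv := ((hη (x - y)).hasFDerivAt.comp y hsub).const_mul c
  refine (congrArg (fun L : Plane →L[ℝ] ℝ => L (EuclideanSpace.single i 1)) hderiv.fderiv).trans ?_
  simp [partialDeriv]

theorem partialDeriv_iterate_const_mul_comp_sub_left (hη : ContDiff ℝ ∞ η) (x : Plane) (c : ℝ)
    (i : Fin 2) (n : ℕ) :
    (partialDeriv i)^[n] (fun y => c * η (x - y)) =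
      fun y => (-1) ^ n * c * (partialDeriv i)^[n] η (x - y) := by
  induction n with
  | zero => simp
  | succ n ih =>
    rw [Function.iterate_succ_apply', Function.iterate_succ_apply', ih,
      partialDeriv_const_mul_comp_sub_left
        ((contDiff_partialDeriv_iterate hη i n).differentiable (by simp))]
    funext y
    ring

theorem mixedDeriv_comp_sub_left (hη : ContDiff ℝ ∞ η) (x : Plane) (α : ℕ × ℕ) :
    mixedDeriv α (fun y => η (x - y)) =
      fun y => (-1) ^ (α.1 + α.2) * mixedDeriv α η (x - y) := by
  have inner := partialDeriv_iterate_const_mul_comp_sub_left hη x 1 1 α.2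
  simp only [one_mul, mul_one] at inner
  unfold mixedDeriv
  rw [inner, partialDeriv_iterate_const_mul_comp_sub_left
    (contDiff_partialDeriv_iterate hη 1 α.2), pow_add]

theorem mixedDeriv_convolution_of_isWeakDeriv {U : Set Plane} (hU : MeasurableSet U)
    (hf : IntegrableOn f U) {α : ℕ × ℕ} (hg : IsWeakDeriv U α f g) (hη : ContDiff ℝ ∞ η)
    (hηc : HasCompactSupport η) {x : Plane} (hx : tsupport (fun y => η (x - y)) ⊆ U) :
    mixedDeriv α (U.indicator f ⋆[lsmul ℝ ℝ] η) x = ∫ y in U, g y * η (x - y) := by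
  have hloc : LocallyIntegrable (U.indicator f) :=
    ((integrable_indicator_iff hU).mpr hf).locallyIntegrable
  have hweak : ∫ y in U, f y * mixedDeriv α (fun y => η (x - y)) y =
      (-1) ^ (α.1 + α.2) * ∫ y in U, g y * η (x - y) :=
    hg _ (hη.comp (contDiff_const.sub contDiff_id))
      (hηc.comp_homeomorph (Homeomorph.subLeft x)) hx
  have hsign : ((-1 : ℝ) ^ (α.1 + α.2)) * (-1) ^ (α.1 + α.2) = 1 := by
    rw [← mul_pow, neg_one_mul, neg_neg, one_pow]
  calc mixedDeriv α (U.indicator f ⋆[lsmul ℝ ℝ] η) x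
      = ∫ y, U.indicator f y * mixedDeriv α η (x - y) := by
        rw [mixedDeriv_convolution hloc hη hηc]
        rfl
    _ = ∫ y in U, f y * mixedDeriv α η (x - y) := by
        rw [← integral_indicator hU]
        simp only [Set.indicator_mul_left]
    _ = (-1) ^ (α.1 + α.2) * ∫ y in U, f y * mixedDeriv α (fun y => η (x - y)) y := by
        rw [mixedDeriv_comp_sub_left hη, ← integral_const_mul]
        congr 1 with y
        linear_combination (-(f y * mixedDeriv α η (x - y))) * hsign
    _ = ∫ y in U, g y * η (x - y) := by
        rw [hweak, ← mul_assoc, hsign, one_mul]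

theorem abs_integral_mul_le {X : Type*} [MeasurableSpace X] {μ : Measure X} {g ψ : X → ℝ} {M : ℝ}
    (hM : ∀ᵐ y ∂μ, |g y| ≤ M) (hψ : Integrable ψ μ) (hψ₀ : ∀ y, 0 ≤ ψ y) :
    |∫ y, g y * ψ y ∂μ| ≤ M * ∫ y, ψ y ∂μ := by
  rw [← Real.norm_eq_abs, ← integral_const_mul]
  refine norm_integral_le_of_norm_le (hψ.const_mul M) ?_
  filter_upwards [hM] with y hy
  rw [norm_mul, Real.norm_eq_abs, Real.norm_of_nonneg (hψ₀ y)]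
  exact mul_le_mul_of_nonneg_right hy (hψ₀ y)

/-- The mollification of `f`, extended by zero outside `U`, by the normalized bump `φ`. -/
noncomputable def mollification (U : Set Plane) (f : Plane → ℝ)
    (φ : ContDiffBump (0 : Plane)) : Plane → ℝ :=
  U.indicator f ⋆[lsmul ℝ ℝ] φ.normed volume

variable {U : Set Plane} (φ : ContDiffBump (0 : Plane))

theorem contDiff_mollification (hU : MeasurableSet U) (hf : IntegrableOn f U) :
    ContDiff ℝ ∞ (mollification U f φ) :=
  φ.hasCompactSupport_normed.contDiff_convolution_right _
    ((integrable_indicator_iff hU).mpr hf).locallyIntegrable φ.contDiff_normed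

theorem tsupport_normed_comp_sub_left_subset (x : Plane) :
    tsupport (fun y => φ.normed volume (x - y)) ⊆ Metric.closedBall x φ.rOut := by
  refine closure_minimal (fun y hy => ?_) Metric.isClosed_closedBall
  have hmem : x - y ∈ Function.support (φ.normed volume) := hy
  rw [φ.support_normed_eq, mem_ball_zero_iff, ← dist_eq_norm, dist_comm] at hmem
  exact hmem.le

theorem abs_mixedDeriv_mollification_le (hU : MeasurableSet U) (hf : IntegrableOn f U)
    {α : ℕ × ℕ} (hg : IsWeakDeriv U α f g) {M : ℝ}
    (hM : ∀ᵐ y ∂volume.restrict U, |g y| ≤ M) {x : Plane}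
    (hx : Metric.closedBall x φ.rOut ⊆ U) :
    |mixedDeriv α (mollification U f φ) x| ≤ M := by
  have hsupport := (tsupport_normed_comp_sub_left_subset φ x).trans hx
  have hintegrable : Integrable fun y => φ.normed volume (x - y) :=
    φ.integrable_normed.comp_sub_left x
  have hone : ∫ y in U, φ.normed volume (x - y) = 1 := by
    rw [setIntegral_eq_integral_of_forall_compl_eq_zero fun y hy =>
        image_eq_zero_of_notMem_tsupport (f := fun y => φ.normed volume (x - y))
          fun h => hy (hsupport h),
      integral_sub_left_eq_self, φ.integral_normed]
  calc |mixedDeriv α (mollification U f φ) x|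
      = |∫ y in U, g y * φ.normed volume (x - y)| := by
        rw [mollification, mixedDeriv_convolution_of_isWeakDeriv hU hf hg φ.contDiff_normed
          φ.hasCompactSupport_normed hsupport]
    _ ≤ M * ∫ y in U, φ.normed volume (x - y) :=
        abs_integral_mul_le hM hintegrable.integrableOn fun y => φ.nonneg_normed _
    _ = M := by rw [hone, mul_one]

theorem abs_mollification_sub_le (hU : MeasurableSet U) (hf : IntegrableOn f U) {x : Plane} {ε : ℝ}
    (hx : Metric.closedBall x φ.rOut ⊆ U)
    (hε : ∀ y ∈ Metric.ball x φ.rOut, |f y - f x| ≤ ε) :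
    |mollification U f φ x - f x| ≤ ε := by
  have hxU : x ∈ U := hx (Metric.mem_closedBall_self φ.rOut_pos.le)
  have hflip : mollification U f φ = φ.normed volume ⋆[lsmul ℝ ℝ] U.indicator f := by
    rw [mollification, ← convolution_flip]
    congr 1
    ext
    simp
  have hdist := φ.dist_normed_convolution_le (μ := volume) (x₀ := x) (g := U.indicator f) (ε := ε)
    ((integrable_indicator_iff hU).mpr hf).aestronglyMeasurable fun y hy => by
      rw [Set.indicator_of_mem hxU, Set.indicator_of_mem (hx (Metric.ball_subset_closedBall hy))]
      exact hε y hy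
  rwa [Set.indicator_of_mem hxU, Real.dist_eq, ← hflip] at hdist

end Mollification

/-! ### The order of approximation -/

section ApproximationOrder

theorem exists_homothety_mapsTo_interior {E : Type*} [NormedAddCommGroup E] [NormedSpace ℝ E]
    {T : Set E} (hconvex : Convex ℝ T) (hbounded : Bornology.IsBounded T) {z : E}
    (hz : z ∈ interior T) {δ : ℝ} (hδ : 0 < δ) :
    ∃ c : ℝ, Set.MapsTo (AffineMap.homothety z c) T (interior T) ∧
      ∀ y ∈ T, dist y (AffineMap.homothety z c y) < δ := by
  have hlim : Filter.Tendsto (fun c : ℝ => (1 - c) * Metric.diam T) (nhdsWithin 1 (Set.Iio 1))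
      (nhds 0) := by
    have hcont : Continuous fun c : ℝ => (1 - c) * Metric.diam T := by fun_prop
    simpa using (hcont.tendsto 1).mono_left nhdsWithin_le_nhds
  have hIco : ∀ᶠ c : ℝ in nhdsWithin 1 (Set.Iio 1), c ∈ Set.Ico 0 1 := Ico_mem_nhdsLT one_pos
  obtain ⟨c, ⟨hc₀, hc₁⟩, hcδ⟩ := (hIco.and (hlim.eventually (gt_mem_nhds hδ))).exists
  refine ⟨c, fun y hy => ?_, fun y hy => lt_of_le_of_lt ?_ hcδ⟩
  · convert hconvex.add_smul_sub_mem_interior hy hz (t := 1 - c) ⟨by linarith, by linarith⟩ using 1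
    rw [AffineMap.homothety_apply, vsub_eq_sub, vadd_eq_add]
    module
  · rw [dist_self_homothety, Real.norm_of_nonneg (by linarith)]
    exact mul_le_mul_of_nonneg_left
      (Metric.dist_le_diam_of_mem hbounded (interior_subset hz) hy) (by linarith)

variable {f : Plane → ℝ}

theorem exists_mollification_near {U K : Set Plane} (hU : IsOpen U) (hK : IsCompact K)
    (hKU : K ⊆ U) (hf : IntegrableOn f U) (hunif : UniformContinuousOn f U) {ε : ℝ} (hε : 0 < ε) :
    ∃ φ : ContDiffBump (0 : Plane), ∀ y ∈ K, Metric.closedBall y φ.rOut ⊆ U ∧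
      |mollification U f φ y - f y| ≤ ε := by
  obtain ⟨δ, hδ, hfδ⟩ := Metric.uniformContinuousOn_iff.mp hunif ε hε
  obtain ⟨r, hr, hrU⟩ := hK.exists_cthickening_subset_open hU hKU
  have hmin : 0 < min r δ := lt_min hr hδ
  let φ : ContDiffBump (0 : Plane) := ⟨min r δ / 2, min r δ, half_pos hmin, half_lt_self hmin⟩
  have hball (y : Plane) (hy : y ∈ K) : Metric.closedBall y φ.rOut ⊆ U :=
    (Metric.closedBall_subset_closedBall (min_le_left r δ)).trans
      ((Metric.closedBall_subset_cthickening hy r).trans hrU)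
  refine ⟨φ, fun y hy => ⟨hball y hy, ?_⟩⟩
  refine abs_mollification_sub_le φ hU.measurableSet hf (hball y hy) fun w hw => ?_
  exact (hfδ w (hball y hy (Metric.ball_subset_closedBall hw)) y (hKU hy)
    ((Metric.mem_ball.mp hw).trans_le (min_le_right r δ))).le

variable {T : Set Plane} {z : Plane}

/-- Contracting `T` towards an interior point makes room for the mollification, so that `G` is
controlled on a whole copy of `T`. -/
theorem exists_contDiff_comp_homothety_near (hcompact : IsCompact T) (hconvex : Convex ℝ T)
    (hz : z ∈ interior T) (hf : ContinuousOn f T) {ε : ℝ} (hε : 0 < ε) :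
    ∃ (c : ℝ) (G : Plane → ℝ), ContDiff ℝ ∞ G ∧ Set.MapsTo (AffineMap.homothety z c) T T ∧
      (∀ y ∈ T, |f y - G (AffineMap.homothety z c y)| ≤ ε) ∧
      ∀ (α : ℕ × ℕ) (g : Plane → ℝ) (M : ℝ), IsWeakDeriv (interior T) α f g →
        (∀ᵐ y ∂volume.restrict (interior T), |g y| ≤ M) →
        ∀ y ∈ T, |mixedDeriv α G (AffineMap.homothety z c y)| ≤ M := by
  have hU : MeasurableSet (interior T) := isOpen_interior.measurableSet
  have hunif := hcompact.uniformContinuousOn_of_continuous hf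
  have hint : IntegrableOn f (interior T) :=
    (hf.integrableOn_compact hcompact).mono_set interior_subset
  obtain ⟨δ, hδ, hfδ⟩ := Metric.uniformContinuousOn_iff.mp hunif (ε / 2) (half_pos hε)
  obtain ⟨c, hmaps, hclose⟩ := exists_homothety_mapsTo_interior hconvex hcompact.isBounded hz hδ
  obtain ⟨φ, hφ⟩ := exists_mollification_near isOpen_interior
    (hcompact.image (AffineMap.homothety_continuous z c)) hmaps.image_subset hint
    (hunif.mono interior_subset) (half_pos hε)
  refine ⟨c, mollification (interior T) f φ, contDiff_mollification φ hU hint,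
    hmaps.mono_right interior_subset, fun y hy => ?_, fun α g M hg hM y hy =>
      abs_mixedDeriv_mollification_le φ hU hint hg hM (hφ _ (Set.mem_image_of_mem _ hy)).1⟩
  have hcontract := (hfδ y hy _ (interior_subset (hmaps hy)) (hclose y hy)).le
  have hmollify := (hφ _ (Set.mem_image_of_mem _ hy)).2
  rw [abs_sub_comm] at hmollify
  exact (abs_sub_le _ _ _).trans ((add_le_add hcontract hmollify).trans_eq (add_halves ε))

theorem exists_mem_polynomialFunctions_near (hcompact : IsCompact T) (hconvex : Convex ℝ T)
    (hz : z ∈ interior T) (hf : ContinuousOn f T) {d : ℕ} {g : ℕ × ℕ → Plane → ℝ} {M : ℝ}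
    (hg : ∀ α : ℕ × ℕ, α.1 + α.2 = d + 1 → IsWeakDeriv (interior T) α f (g α))
    (hM : ∀ α : ℕ × ℕ, α.1 + α.2 = d + 1 → ∀ᵐ y ∂volume.restrict (interior T), |g α y| ≤ M)
    {ε : ℝ} (hε : 0 < ε) :
    ∃ p ∈ polynomialFunctions d, ∀ y ∈ T,
      |f y - p y| ≤ (2 * Metric.diam T) ^ (d + 1) * M / d.factorial + ε := by
  obtain ⟨c, G, hG, hmaps, hclose, hderiv⟩ :=
    exists_contDiff_comp_homothety_near hcompact hconvex hz hf hε
  set σ := AffineMap.homothety z c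
  have hzT : z ∈ T := interior_subset hz
  refine ⟨fun y => taylorPolynomial d G z ((σ - AffineMap.const ℝ Plane z) y),
    taylorPolynomial_comp_mem_polynomialFunctions d G z _, fun y hy => ?_⟩
  have hbound (α : ℕ × ℕ) (hα : α.1 + α.2 = d + 1) (x : Plane) (hx : x ∈ T) :
      |mixedDeriv α G (σ x)| ≤ M := hderiv α (g α) M (hg α hα) (hM α hα) x hx
  have hM₀ : 0 ≤ M := (abs_nonneg _).trans (hbound (d + 1, 0) rfl z hzT)
  have htaylor : |G (σ y) - taylorPolynomial d G z (σ y - z)| ≤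
      (2 * ‖σ y - z‖) ^ (d + 1) * M / d.factorial := by
    rw [← add_sub_cancel z (σ y), add_sub_cancel_left]
    refine abs_sub_taylorPolynomial_le hG d fun s hs α hα => ?_
    have hline : z + s • (σ y - z) = σ (z + s • (y - z)) := by
      simp only [σ, AffineMap.homothety_apply, vsub_eq_sub, vadd_eq_add]
      module
    rw [hline]
    exact hbound α hα _ (hconvex.add_smul_sub_mem hzT hy hs)
  have hdiam : ‖σ y - z‖ ≤ Metric.diam T := by
    rw [← dist_eq_norm]
    exact Metric.dist_le_diam_of_mem hcompact.isBounded (hmaps hy) hzT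
  calc |f y - taylorPolynomial d G z (σ y - z)|
      ≤ |f y - G (σ y)| + |G (σ y) - taylorPolynomial d G z (σ y - z)| := abs_sub_le _ _ _
    _ ≤ ε + (2 * Metric.diam T) ^ (d + 1) * M / d.factorial := by
        refine add_le_add (hclose y hy) (htaylor.trans ?_)
        gcongr
    _ = _ := add_comm _ _

theorem sobolevSeminorm_nonneg (U : Set Plane) (m : ℕ) (g : ℕ × ℕ → Plane → ℝ) :
    0 ≤ sobolevSeminorm U m g :=
  ENNReal.toReal_nonneg

theorem ae_abs_le_sobolevSeminorm {U : Set Plane} {m : ℕ} {g : ℕ × ℕ → Plane → ℝ}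
    (hg : ∀ α : ℕ × ℕ, α.1 + α.2 = m → MemLp (g α) ∞ (volume.restrict U)) {α : ℕ × ℕ}
    (hα : α.1 + α.2 = m) :
    ∀ᵐ y ∂volume.restrict U, |g α y| ≤ sobolevSeminorm U m g := by
  have hfin : (Finset.HasAntidiagonal.antidiagonal m).sup
      (fun α => eLpNorm (g α) ∞ (volume.restrict U)) < ⊤ :=
    (Finset.sup_lt_iff ENNReal.zero_lt_top).mpr fun β hβ =>
      (hg β (Finset.HasAntidiagonal.mem_antidiagonal.mp hβ)).2
  have hle : eLpNorm (g α) ∞ (volume.restrict U) ≤ (Finset.HasAntidiagonal.antidiagonal m).sup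
      (fun α => eLpNorm (g α) ∞ (volume.restrict U)) :=
    Finset.le_sup (f := fun α => eLpNorm (g α) ∞ (volume.restrict U))
      (Finset.HasAntidiagonal.mem_antidiagonal.mpr hα)
  rw [eLpNorm_exponent_top] at hle
  filter_upwards [ae_le_eLpNormEssSup (f := g α) (μ := volume.restrict U)] with y hy
  simpa [sobolevSeminorm] using ENNReal.toReal_mono hfin.ne (hy.trans hle)

theorem abs_quasiInterpolant_sub_le_sobolevSeminorm {b : AffineBasis (Fin 3) ℝ Plane}
    {ρ : Plane → Fin 12} {x : Plane} (hx : x ∈ face b (ρ x)) (n : Fin 6) {d : ℕ} (hd : d ≤ 5)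
    (hf : ContinuousOn f (triangle b)) {g : ℕ × ℕ → Plane → ℝ}
    (hg : ∀ α : ℕ × ℕ, α.1 + α.2 = d + 1 →
      MemLp (g α) ∞ (volume.restrict (interior (triangle b))) ∧
        IsWeakDeriv (interior (triangle b)) α f (g α)) :
    |quasiInterpolant b ρ n f x - f x| ≤ 278 / 3 * (2 ^ (d + 1) / d.factorial) *
      Metric.diam (triangle b) ^ (d + 1) *
        sobolevSeminorm (interior (triangle b)) (d + 1) g := by
  obtain ⟨z, hz⟩ := interior_triangle_nonempty b
  refine le_of_forall_pos_le_add fun ε hε => ?_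
  obtain ⟨p, hp, hfp⟩ := exists_mem_polynomialFunctions_near (isCompact_triangle b)
    (convex_convexHull ℝ _) hz hf (fun α hα => (hg α hα).2)
    (fun α hα => ae_abs_le_sobolevSeminorm (fun β hβ => (hg β hβ).1) hα)
    (show 0 < 3 / 278 * ε by positivity)
  refine (abs_quasiInterpolant_sub_le hx n (polynomialFunctions_mono hd hp) hfp).trans_eq ?_
  rw [mul_pow]
  ring

end ApproximationOrder

end PS12

theorem mainTheorem7_general {v : Fin 3 → Plane} (hv : AffineIndependent ℝ v)
    {ρ : Plane → Fin 12} (hρ : IsFaceScheme v ρ) (n : Fin 6) :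
    (∀ f : Plane → ℝ, quasiInterpolant v ρ n f ∈ splineSpace v 3 5) ∧
    (∀ p ∈ polynomialFunctions 5, ∀ x ∈ triangle v, quasiInterpolant v ρ n p x = p x) ∧
    (∀ f : Plane → ℝ, BddAbove ((fun x => |f x|) '' triangle v) →
      supNorm (triangle v) (quasiInterpolant v ρ n f) ≤ 275 / 3 * supNorm (triangle v) f) ∧
    ∀ d ≤ 5, ∀ (f : Plane → ℝ) (g : ℕ × ℕ → Plane → ℝ), ContinuousOn f (triangle v) →
      (∀ α : ℕ × ℕ, α.1 + α.2 = d + 1 →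
        MemLp (g α) ∞ (volume.restrict (interior (triangle v))) ∧
          IsWeakDeriv (interior (triangle v)) α f (g α)) →
      supNorm (triangle v) (fun x => quasiInterpolant v ρ n f x - f x) ≤
        278 / 3 * (2 ^ (d + 1) / d.factorial) * Metric.diam (triangle v) ^ (d + 1) *
          sobolevSeminorm (interior (triangle v)) (d + 1) g := by
  obtain ⟨b, rfl⟩ := exists_affineBasis_coe_eq hv
  refine ⟨quasiInterpolant_mem_splineSpace hρ n, fun p hp x hx =>
    quasiInterpolant_of_mem_polynomialFunctions (hρ x hx) n hp, fun f hf => ?_,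
    fun d hd f g hf hg => ?_⟩
  · exact supNorm_le (mul_nonneg (by norm_num) supNorm_nonneg) fun x hx =>
      abs_quasiInterpolant_le (hρ x hx) n fun y hy => abs_le_supNorm hf hy
  · have := sobolevSeminorm_nonneg (interior (triangle b)) (d + 1) g
    exact supNorm_le (by positivity) fun x hx =>
      abs_quasiInterpolant_sub_le_sobolevSeminorm (hρ x hx) n hd hf hg

theorem mainTheorem7 :
    (∀ (n : Fin 6) (v : Fin 3 → Plane), AffineIndependent ℝ v →
      ∀ ρ : Plane → Fin 12, IsFaceScheme v ρ →
        (∀ f : Plane → ℝ, ContinuousOn f (triangle v) →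
          quasiInterpolant v ρ n f ∈ splineSpace v 3 5) ∧
        (∀ p : MvPolynomial (Fin 2) ℝ, p.totalDegree ≤ 5 → ∀ x ∈ triangle v,
          quasiInterpolant v ρ n (fun y => MvPolynomial.eval (fun i => y i) p) x =
            MvPolynomial.eval (fun i => x i) p) ∧
        (∀ f : Plane → ℝ, ContinuousOn f (triangle v) →
          supNorm (triangle v) (quasiInterpolant v ρ n f) ≤
            275 / 3 * supNorm (triangle v) f)) ∧
    ∃ C : ℝ, ∀ (n : Fin 6) (v : Fin 3 → Plane), AffineIndependent ℝ v →
      ∀ ρ : Plane → Fin 12, IsFaceScheme v ρ →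
        ∀ (f : Plane → ℝ) (g : ℕ × ℕ → Plane → ℝ), ContinuousOn f (triangle v) →
          IsSobolevWith (interior (triangle v)) 6 f g →
          supNorm (triangle v) (fun x => quasiInterpolant v ρ n f x - f x) ≤
            C * Metric.diam (triangle v) ^ 6 *
              sobolevSeminorm (interior (triangle v)) 6 g := by
  refine ⟨fun n v hv ρ hρ => ?_, 278 / 3 * (2 ^ (5 + 1) / Nat.factorial 5),
    fun n v hv ρ hρ f g hf hg => ?_⟩
  · obtain ⟨hspline, hpoly, hnorm, -⟩ := mainTheorem7_general hv hρ n
    exact ⟨fun f _ => hspline f,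
      fun p hp => hpoly _ (mem_polynomialFunctions_iff.mpr ⟨p, hp, fun _ => rfl⟩),
      fun f hf => hnorm f ((isCompact_triangle v).bddAbove_image hf.abs)⟩
  · obtain ⟨-, -, -, happrox⟩ := mainTheorem7_general hv hρ n
    exact happrox 5 le_rfl f g hf fun α hα => hg α hα.le
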